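/- **Setting.** A Smale space $(X,\varphi)$ is a homeomorphism $\varphi$ of a compact metric space $(X,d)$ with constants $\varepsilon_X>0$, $0<\lambda<1$ and a continuous bracket $[\cdot,\cdot]\colon\{(x,y): d(x,y)\le\varepsilon_X\}\to X$ such that, whenever both sides are defined, $[x,x]=x$, $[x,[y,z]]=[x,z]$, $[[x,y],z]=[x,z]$, $[\varphi x,\varphi y]=\varphi[x,y]$, and such that $d(\varphi y,\varphi z)\le\lambda d(y,z)$ if $[y,z]=z$ and $d(\varphi^{-1}y,\varphi^{-1}z)\le\lambda d(y,z)$ if $[y,z]=y$. Let $X^s(x)=\{y:\lim_{n\to+\infty}d(\varphi^n x,\varphi^n y)=0\}$ and $X^u(x)=\{y:\lim_{n\to+\infty}d(\varphi^{-n} x,\varphi^{-n} y)=0\}$, with the topologies generated by the local sets $X^s(x,\delta)=\{y: d(x,y)<\delta,\ [y,x]=x\}$ and $X^u(x,\delta)=\{y:d(x,y)<\delta,\ [x,y]=x\}$, $0<\delta\le\varepsilon_X$. A map of Smale spaces is a continuous map $f$ that intertwines the homeomorphisms; it is $s$-bijective (resp. $u$-bijective) if it maps $X^s(x)$ (resp.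 $X^u(x)$) bijectively onto the stable (resp. unstable) set of $f(x)$ for every $x$. Let $CO^s(X)$ be the family of all subsets of $X$ that are contained in some $X^s(e)$ and are compact and open in it. Let $\sim$ be the smallest equivalence relation on $CO^s(X)$ such that (i) $E\sim F$ if $E$ and $F$ lie in local stable sets $X^s(e,\varepsilon_X/2)$, $X^s(f,\varepsilon_X/2)$, all brackets between $E$ and $F$ are defined, and $[E,F]=E$, $[F,E]=F$; (ii) $E\sim F$ if and only if $\varphi(E)\sim\varphi(F)$. The dimension group $D^s(X)$ is the free abelian group on the $\sim$-classes $[E]$ modulo the subgroup generated by all $[E\cup F]-[E]-[F]$ with $E,F,E\cup F\in CO^s(X)$ and $E\cap F=\emptyset$. Let $(X,\varphi)$ be a non-wandering Smale space and $\pi=(Y,\psi,\pi_s,Z,\zeta,\pi_u)$ an $s/u$-bijective pair for it: $(Y,\psi)$, $(Z,\zeta)$ are Smale spaces, $\pi_s\colon Y\to X$ is a surjective $s$-bijective map, $\pi_u\colon Z\to X$ is a surjective $u$-bijective map, and all $Y^u(y)$ and all $Z^s(z)$ are totally disconnected. For $L,M\ge0$ let $$\Sigma_{L,M}=\{(y_0,\dots,y_L,z_0,\dots,z_M)\in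 Y^{L+1}\times Z^{M+1}:\ \pi_s(y_l)=\pi_u(z_m)\text{ for all }l,m\},$$ a Smale space under the maximum metric, the product homeomorphism and the coordinatewise bracket. Order-preserving maps $\alpha\colon\{0,\dots,L'\}\to\{0,\dots,L\}$ and $\beta\colon\{0,\dots,M'\}\to\{0,\dots,M\}$ give maps $\alpha^*\colon\Sigma_{L,M}\to\Sigma_{L',M}$, $(y,z)\mapsto(y\circ\alpha,z)$, and $\beta^*\colon\Sigma_{L,M}\to\Sigma_{L,M'}$, $(y,z)\mapsto(y,z\circ\beta)$, which make $\Sigma_{\bullet,\bullet}$ a bisimplicial space. Its faces $\delta_l$, $\delta_{,m}$ delete $y_l$, $z_m$; its degeneracies $s_l$, $s_{,m}$ repeat $y_l$, $z_m$. **Theorem.** 1. For all $\alpha$ and $\beta$ as above, $[E]\mapsto[\alpha^*(E)]$ is a well-defined homomorphism $D^s(\Sigma_{L,M})\to D^s(\Sigma_{L',M})$ (and $\alpha^*(E)\in CO^s(\Sigma_{L',M})$ for $E\in CO^s(\Sigma_{L,M})$), and $[E]\mapsto[(\beta^*)^{-1}(E)]$ is a well-defined homomorphism $D^s(\Sigma_{L,M'})\to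 D^s(\Sigma_{L,M})$; here $(\beta^*)^{-1}(E)$ is a finite disjoint union of sets $P_i\in CO^s(\Sigma_{L,M})$, and $[(\beta^*)^{-1}(E)]$ stands for $\sum_i[P_i]$, which does not depend on the choice of the $P_i$. 2. With these homomorphisms, $([L],[M])\mapsto D^s(\Sigma_{L,M})$ is a functor $\Delta^{op}\times\Delta\to\mathbf{Ab}$, that is, a simplicial cosimplicial abelian group. Its faces, degeneracies, cofaces and codegeneracies are the maps $\delta_l^s$, $s_l^s$, $\delta_{,m}^{s*}$, $s_{,m}^{s*}$ induced by $\delta_l$, $s_l$, $\delta_{,m}$, $s_{,m}$. 3. Let $C_{L,M}=D^s(\Sigma_{L,M})$ for $L,M\ge0$ (and $C_{L,M}=0$ otherwise), $$\partial^s=\sum_{l=0}^{L}(-1)^l\delta_l^s\colon C_{L,M}\to C_{L-1,M}\ (L\ge1),\qquad \partial^{s*}=\sum_{m=0}^{M+1}(-1)^{L+m}\delta_{,m}^{s*}\colon C_{L,M}\to C_{L,M+1}.$$ Then $\partial^s\partial^s=0$, $\partial^{s*}\partial^{s*}=0$ and $\partial^s\partial^{s*}+\partial^{s*}\partial^s=0$,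 and Putnam's double complex $(C_{L,M},\partial^s,\partial^{s*})$ is equal to the unnormalized double complex of the simplicial cosimplicial group in 2. The latter has horizontal differential the alternating sum of the faces and vertical differential $(-1)^L$ times the alternating sum of the cofaces (the usual sign convention, which makes the differentials anticommute). -/

import Mathlib

open CategoryTheory Opposite

/-- A Smale space: a homeomorphism `φ` of a compact metric space with a bracket `[x, y]`, defined and
jointly continuous for `d(x, y) ≤ ε`, satisfying the axioms B1-B4, C1, C2 of Ruelle and Putnam.
(`bracket` is a total function; only its values at pairs with `d(x, y) ≤ ε` matter.) -/
structure SmaleSpace (X : Type*) [MetricSpace X] [CompactSpace X] where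
  φ : X ≃ₜ X
  ε : ℝ
  lam : ℝ
  bracket : X → X → X
  ε_pos : 0 < ε
  lam_pos : 0 < lam
  lam_lt_one : lam < 1
  continuousOn_bracket :
    ContinuousOn (fun p : X × X => bracket p.1 p.2) {p | dist p.1 p.2 ≤ ε}
  B1 : ∀ x, bracket x x = x
  B2 : ∀ x y z, dist y z ≤ ε → dist x (bracket y z) ≤ ε → dist x z ≤ ε →
    bracket x (bracket y z) = bracket x z
  B3 : ∀ x y z, dist x y ≤ ε → dist (bracket x y) z ≤ ε → dist x z ≤ ε →
    bracket (bracket x y) z = bracket x z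
  B4 : ∀ x y, dist x y ≤ ε → dist (φ x) (φ y) ≤ ε →
    bracket (φ x) (φ y) = φ (bracket x y)
  C1 : ∀ y z, dist y z ≤ ε → bracket y z = z → dist (φ y) (φ z) ≤ lam * dist y z
  C2 : ∀ y z, dist y z ≤ ε → bracket y z = y → dist (φ.symm y) (φ.symm z) ≤ lam * dist y z

namespace SmaleSpace

section Basic

variable {X : Type*} [MetricSpace X] [CompactSpace X] (S : SmaleSpace X)

/-- Every point is non-wandering. -/
def NonWandering : Prop :=
  ∀ (x : X) (U : Set X), IsOpen U → x ∈ U → ∃ n : ℕ, 0 < n ∧ ((S.φ^[n] '' U) ∩ U).Nonempty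

/-- The global stable set `X^s(x)`. -/
def globalStable (x : X) : Set X :=
  {y | Filter.Tendsto (fun n : ℕ => dist (S.φ^[n] x) (S.φ^[n] y)) Filter.atTop (nhds 0)}

/-- The global unstable set `X^u(x)`. -/
def globalUnstable (x : X) : Set X :=
  {y | Filter.Tendsto (fun n : ℕ => dist (S.φ.symm^[n] x) (S.φ.symm^[n] y)) Filter.atTop (nhds 0)}

/-- The local stable set `X^s(x, δ)`, for `0 < δ ≤ ε`. -/
def localStable (x : X) (δ : ℝ) : Set X :=
  {y | dist x y < δ ∧ S.bracket y x = x}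

/-- The local unstable set `X^u(x, δ)`, for `0 < δ ≤ ε`. -/
def localUnstable (x : X) (δ : ℝ) : Set X :=
  {y | dist x y < δ ∧ S.bracket x y = x}

/-- The topology on `X` generated by the local stable sets. Every global stable set is open in it, and
the topology it induces on `X^s(x)` is the usual (inductive limit) topology of `X^s(x)`. -/
@[reducible] def stableTopology : TopologicalSpace X :=
  TopologicalSpace.generateFrom {U | ∃ x δ, 0 < δ ∧ δ ≤ S.ε ∧ U = S.localStable x δ}

/-- The topology on `X` generated by the local unstable sets. -/
@[reducible] def unstableTopology : TopologicalSpace X :=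
  TopologicalSpace.generateFrom {U | ∃ x δ, 0 < δ ∧ δ ≤ S.ε ∧ U = S.localUnstable x δ}

/-- `CO^s`: the compact open subsets of the global stable sets. -/
def CO : Type _ :=
  {E : Set X // (∃ e, E ⊆ S.globalStable e) ∧
    @IsCompact X S.stableTopology E ∧ @IsOpen X S.stableTopology E}

/-- `[E, F] = E` and `[F, E] = F`, all brackets being defined, where `E` and `F` lie in local stable
sets. -/
def Holonomic (E F : Set X) : Prop :=
  (∃ e, E ⊆ S.localStable e (S.ε / 2)) ∧ (∃ f, F ⊆ S.localStable f (S.ε / 2)) ∧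
  (∀ e ∈ E, ∀ f ∈ F, dist e f ≤ S.ε) ∧
  Set.image2 S.bracket E F = E ∧ Set.image2 S.bracket F E = F

/-- The smallest equivalence relation on `CO^s` that contains `Holonomic` and satisfies
`E ∼ F ↔ φ(E) ∼ φ(F)`. -/
inductive Rel : S.CO → S.CO → Prop
  | holonomic (E F : S.CO) : S.Holonomic E.1 F.1 → Rel E F
  | shift (E F E' F' : S.CO) : E'.1 = S.φ '' E.1 → F'.1 = S.φ '' F.1 → Rel E F → Rel E' F'
  | unshift (E F E' F' : S.CO) : E'.1 = S.φ '' E.1 → F'.1 = S.φ '' F.1 → Rel E' F' → Rel E F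
  | refl (E : S.CO) : Rel E E
  | symm (E F : S.CO) : Rel E F → Rel F E
  | trans (E F G : S.CO) : Rel E F → Rel F G → Rel E G

/-- `Rel` as a setoid. -/
def relSetoid : Setoid S.CO where
  r := S.Rel
  iseqv := ⟨Rel.refl, fun h => Rel.symm _ _ h, fun h h' => Rel.trans _ _ _ h h'⟩

/-- The generator of the free abelian group attached to the class of `E`. -/
def freeCls (E : S.CO) : FreeAbelianGroup (Quotient S.relSetoid) :=
  FreeAbelianGroup.of (Quotient.mk S.relSetoid E)

/-- The subgroup generated by `[E ∪ F] - [E] - [F]` for disjoint `E`, `F`. -/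
def additivity : AddSubgroup (FreeAbelianGroup (Quotient S.relSetoid)) :=
  AddSubgroup.closure {a | ∃ E F G : S.CO, Disjoint E.1 F.1 ∧ G.1 = E.1 ∪ F.1 ∧
    a = S.freeCls G - S.freeCls E - S.freeCls F}

/-- The (stable) dimension group `D^s`. -/
abbrev Ds : Type _ := FreeAbelianGroup (Quotient S.relSetoid) ⧸ S.additivity

/-- The class `[E]` in `D^s`. -/
def cls (E : S.CO) : S.Ds := QuotientAddGroup.mk (S.freeCls E)

end Basic

section Maps

variable {A B : Type*} [MetricSpace A] [CompactSpace A] [MetricSpace B] [CompactSpace B]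
  (S : SmaleSpace A) (T : SmaleSpace B)

/-- A map of Smale spaces. -/
def IsMap (f : A → B) : Prop :=
  Continuous f ∧ ∀ x, f (S.φ x) = T.φ (f x)

/-- `f` is `s`-bijective. -/
def SBijective (f : A → B) : Prop :=
  ∀ x, Set.BijOn f (S.globalStable x) (T.globalStable (f x))

/-- `f` is `u`-bijective. -/
def UBijective (f : A → B) : Prop :=
  ∀ x, Set.BijOn f (S.globalUnstable x) (T.globalUnstable (f x))

/-- `g` is the map `[E] ↦ [f(E)]`. -/
def IsPush (f : A → B) (g : S.Ds →+ T.Ds) : Prop :=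
  ∀ E : S.CO, ∃ E' : T.CO, E'.1 = f '' E.1 ∧ g (S.cls E) = T.cls E'

/-- `P` is a partition of `f⁻¹(E)` into finitely many members of `CO^s`. -/
def IsPreimagePartition (f : A → B) (E : T.CO) {n : ℕ} (P : Fin n → S.CO) : Prop :=
  (∀ i j, i ≠ j → Disjoint (P i).1 (P j).1) ∧ (⋃ i, (P i).1) = f ⁻¹' E.1

/-- `g` is the map `[E] ↦ [f⁻¹(E)]`: the set `f⁻¹(E)` (which may meet several stable sets) is a finite
disjoint union of members `P i` of `CO^s`, and `[E]` goes to `∑ [P i]`, for any such partition. -/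
def IsPull (f : A → B) (g : T.Ds →+ S.Ds) : Prop :=
  ∀ E : T.CO,
    (∃ (n : ℕ) (P : Fin n → S.CO), S.IsPreimagePartition T f E P) ∧
    ∀ (n : ℕ) (P : Fin n → S.CO), S.IsPreimagePartition T f E P →
      g (T.cls E) = ∑ i, S.cls (P i)

open Classical in
/-- The map `f^s : [E] ↦ [f(E)]` on dimension groups (zero if there is no such homomorphism). -/
noncomputable def push (f : A → B) : S.Ds →+ T.Ds :=
  if h : ∃ g, S.IsPush T f g then h.choose else 0

open Classical in
/-- The map `f^{s*} : [E] ↦ [f⁻¹(E)]` on dimension groups (zero if there is no such homomorphism). -/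
noncomputable def pull (f : A → B) : T.Ds →+ S.Ds :=
  if h : ∃ g, S.IsPull T f g then h.choose else 0

end Maps

section BracketLemmas

variable {X : Type*} [MetricSpace X] [CompactSpace X]

/-- The inverse system. -/
def inv (S : SmaleSpace X) : SmaleSpace X where
  φ := S.φ.symm
  ε := S.ε
  lam := S.lam
  bracket x y := S.bracket y x
  ε_pos := S.ε_pos
  lam_pos := S.lam_pos
  lam_lt_one := S.lam_lt_one
  continuousOn_bracket := by
    refine S.continuousOn_bracket.comp continuous_swap.continuousOn ?_
    intro p hp
    simpa [dist_comm] using hp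
  B1 := S.B1
  B2 x y z h1 h2 h3 := by
    rw [dist_comm] at h1 h2 h3
    exact S.B3 _ _ _ h1 h2 h3
  B3 x y z h1 h2 h3 := by
    rw [dist_comm] at h1 h2 h3
    exact S.B2 _ _ _ h1 h2 h3
  B4 x y h1 h2 := by
    rw [dist_comm] at h1 h2
    have := S.B4 (S.φ.symm y) (S.φ.symm x) h2 (by simpa using h1)
    apply S.φ.injective
    simpa using this.symm
  C1 y z h1 h2 := by
    rw [dist_comm] at h1
    rw [dist_comm, dist_comm y z]
    exact S.C2 _ _ h1 h2
  C2 y z h1 h2 := by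
    rw [dist_comm] at h1
    rw [dist_comm, dist_comm y z]
    exact S.C1 _ _ h1 h2

theorem bracket_near (S : SmaleSpace X) {η : ℝ} (hη : 0 < η) :
    ∃ δ > 0, δ ≤ S.ε ∧ ∀ x y, dist x y ≤ δ →
      dist (S.bracket x y) x < η ∧ dist (S.bracket x y) y < η := by
  have hK : IsCompact {p : X × X | dist p.1 p.2 ≤ S.ε} :=
    (isClosed_le continuous_dist continuous_const).isCompact
  have hu := hK.uniformContinuousOn_of_continuous S.continuousOn_bracket
  rw [Metric.uniformContinuousOn_iff] at hu
  obtain ⟨δ, hδ, h⟩ := hu (η / 2) (by linarith)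
  refine ⟨min (min (δ / 2) (η / 2)) S.ε, ?_, min_le_right _ _, ?_⟩
  · have := S.ε_pos
    positivity
  intro x y hxy
  have h1 : dist x y ≤ δ / 2 := hxy.trans ((min_le_left _ _).trans (min_le_left _ _))
  have h2 : dist x y ≤ η / 2 := hxy.trans ((min_le_left _ _).trans (min_le_right _ _))
  have h3 : dist x y ≤ S.ε := hxy.trans (min_le_right _ _)
  have h4 := h (x, y) h3 (x, x) (by simpa using S.ε_pos.le) (by
    rw [Prod.dist_eq]
    simp only [dist_self]
    rw [dist_comm y x]
    exact max_lt hδ (by linarith))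
  simp only [S.B1] at h4
  refine ⟨by linarith, ?_⟩
  have := dist_triangle (S.bracket x y) x y
  linarith

theorem stable_iterate (S : SmaleSpace X) {y w : X} (h : dist y w ≤ S.ε)
    (hb : S.bracket y w = w) (n : ℕ) :
    dist (S.φ^[n] y) (S.φ^[n] w) ≤ S.lam ^ n * dist y w ∧
      dist (S.φ^[n] y) (S.φ^[n] w) ≤ S.ε ∧
      S.bracket (S.φ^[n] y) (S.φ^[n] w) = S.φ^[n] w := by
  induction n with
  | zero => simpa using ⟨h, hb⟩
  | succ n ih =>
    obtain ⟨h1, h2, h3⟩ := ih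
    have h4 := S.C1 _ _ h2 h3
    have h5 : S.lam * dist (S.φ^[n] y) (S.φ^[n] w) ≤ dist (S.φ^[n] y) (S.φ^[n] w) :=
      mul_le_of_le_one_left dist_nonneg S.lam_lt_one.le
    simp only [Function.iterate_succ_apply']
    refine ⟨?_, h4.trans (h5.trans h2), ?_⟩
    · calc _ ≤ _ := h4
        _ ≤ S.lam * (S.lam ^ n * dist y w) := mul_le_mul_of_nonneg_left h1 S.lam_pos.le
        _ = _ := by ring
    · rw [S.B4 _ _ h2 (h4.trans (h5.trans h2)), h3]

theorem stable_iterate_le (S : SmaleSpace X) {y w : X} (h : dist y w ≤ S.ε)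
    (hb : S.bracket y w = w) (n : ℕ) :
    dist (S.φ^[n] y) (S.φ^[n] w) ≤ dist y w :=
  (S.stable_iterate h hb n).1.trans
    (mul_le_of_le_one_left dist_nonneg (pow_le_one₀ S.lam_pos.le S.lam_lt_one.le))

theorem exists_shadow (S : SmaleSpace X) :
    ∃ δ > 0, δ ≤ S.ε ∧ ∀ a b, (∀ n : ℕ, dist (S.φ^[n] b) (S.φ^[n] a) ≤ δ) →
      S.bracket b a = a := by
  obtain ⟨δ, hδ, hδε, h⟩ := S.bracket_near S.ε_pos
  refine ⟨δ, hδ, hδε, fun a b hab => ?_⟩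
  have hv : ∀ n : ℕ, S.bracket (S.φ^[n] b) (S.φ^[n] a) = S.φ^[n] (S.bracket b a) := by
    intro n
    induction n with
    | zero => rfl
    | succ n ih =>
      have h1 := (hab n).trans hδε
      have h2 := (hab (n + 1)).trans hδε
      simp only [Function.iterate_succ_apply'] at h2 ⊢
      rw [S.B4 _ _ h1 h2, ih]
  have hd : ∀ n : ℕ, dist (S.bracket b a) a ≤ S.lam ^ n * S.ε := by
    intro n
    have h1 := (h _ _ (hab n)).2.le
    have h2 := (hab n).trans hδε
    have h3 : S.inv.bracket (S.φ^[n] a) (S.φ^[n] (S.bracket b a)) =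
        S.φ^[n] (S.bracket b a) := by
      rw [← hv n]
      exact S.B3 _ _ _ h2 h1 h2
    rw [hv n] at h1
    have h4 := (S.inv.stable_iterate (by rw [dist_comm]; exact h1) h3 n).1
    have h5 : ∀ x, S.inv.φ^[n] (S.φ^[n] x) = x :=
      Function.LeftInverse.iterate (fun x => S.φ.symm_apply_apply x) n
    rw [h5, h5, dist_comm, dist_comm (S.φ^[n] a)] at h4
    exact h4.trans (mul_le_mul_of_nonneg_left h1 (pow_nonneg S.lam_pos.le n))
  have hlim : Filter.Tendsto (fun n : ℕ => S.lam ^ n * S.ε) Filter.atTop (nhds (0 * S.ε)) :=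
    (tendsto_pow_atTop_nhds_zero_of_lt_one S.lam_pos.le S.lam_lt_one).mul_const _
  rw [zero_mul] at hlim
  exact dist_le_zero.1 (ge_of_tendsto' hlim hd)

variable {Y : Type*} [MetricSpace Y] [CompactSpace Y]

/-- Maps of Smale spaces preserve brackets of sufficiently close points. -/
theorem exists_bracket_map (S : SmaleSpace Y) (T : SmaleSpace X) {f : Y → X} (hf : S.IsMap T f) :
    ∃ δ > 0, δ ≤ S.ε ∧ ∀ y y', dist y y' ≤ δ →
      f (S.bracket y y') = T.bracket (f y) (f y') := by
  obtain ⟨δ₁, hδ₁, hδ₁ε, hs⟩ := T.exists_shadow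
  obtain ⟨δ₂, hδ₂, hδ₂ε, hu⟩ := T.inv.exists_shadow
  change δ₂ ≤ T.ε at hδ₂ε
  have huc := CompactSpace.uniformContinuous_of_continuous hf.1
  rw [Metric.uniformContinuous_iff] at huc
  obtain ⟨η, hη, hfη⟩ := huc (min δ₁ δ₂) (lt_min hδ₁ hδ₂)
  obtain ⟨δ, hδ, hδε, hb⟩ := S.bracket_near (lt_min hη S.ε_pos)
  refine ⟨min δ (η / 2), lt_min hδ (by linarith), (min_le_left _ _).trans hδε, ?_⟩
  intro y y' hyy
  have hyδ := hyy.trans (min_le_left _ _)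
  have hyη : dist y y' < η := (hyy.trans (min_le_right _ _)).trans_lt (by linarith)
  obtain ⟨h1, h2⟩ := hb y y' hyδ
  set w := S.bracket y y' with hw
  have h1ε : dist y w ≤ S.ε := by rw [dist_comm]; exact (h1.trans_le (min_le_right _ _)).le
  have h2ε : dist w y' ≤ S.ε := (h2.trans_le (min_le_right _ _)).le
  have hyε := hyδ.trans hδε
  have e1 : S.bracket y w = w := S.B2 _ _ _ hyε h1ε hyε
  have e2 : S.inv.bracket y' w = w := S.B3 _ _ _ hyε h2ε hyε
  have it1 : ∀ (n : ℕ) x, f (S.φ^[n] x) = T.φ^[n] (f x) := by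
    intro n x
    exact (Function.Semiconj.iterate_right (f := f) (ga := S.φ) (gb := T.φ) hf.2 n) x
  have it2 : ∀ (n : ℕ) x, f (S.inv.φ^[n] x) = T.inv.φ^[n] (f x) := by
    intro n x
    refine (Function.Semiconj.iterate_right (f := f) (ga := S.inv.φ) (gb := T.inv.φ) ?_ n) x
    intro x
    apply T.φ.injective
    change T.φ (f (S.φ.symm x)) = T.φ (T.φ.symm (f x))
    rw [← hf.2]
    simp
  have f1 : T.bracket (f y) (f w) = f w := by
    refine hs _ _ fun n => ?_
    rw [← it1, ← it1]
    refine ((hfη ?_).trans_le (min_le_left _ _)).le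
    refine (S.stable_iterate_le h1ε e1 n).trans_lt ?_
    rw [dist_comm]
    exact h1.trans_le (min_le_left _ _)
  have f2 : T.inv.bracket (f y') (f w) = f w := by
    refine hu _ _ fun n => ?_
    rw [← it2, ← it2]
    refine ((hfη ?_).trans_le (min_le_right _ _)).le
    refine (S.inv.stable_iterate_le (by rw [dist_comm]; exact h2ε) e2 n).trans_lt ?_
    rw [dist_comm]
    exact h2.trans_le (min_le_left _ _)
  change T.bracket (f w) (f y') = f w at f2
  have g1 : dist (f y) (f w) ≤ T.ε := by
    refine ((hfη ?_).trans_le ((min_le_left _ _).trans hδ₁ε)).le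
    rw [dist_comm]
    exact h1.trans_le (min_le_left _ _)
  have g2 : dist (f w) (f y') ≤ T.ε :=
    ((hfη (h2.trans_le (min_le_left _ _))).trans_le ((min_le_left _ _).trans hδ₁ε)).le
  have g3 : dist (f y) (f y') ≤ T.ε :=
    ((hfη hyη).trans_le ((min_le_left _ _).trans hδ₁ε)).le
  have := T.B3 (f y) (f w) (f y') g1 (by rw [f1]; exact g2) g3
  rw [f1, f2] at this
  exact this

end BracketLemmas

end SmaleSpace

/-- An `s/u`-bijective pair `π = (Y, ψ, π_s, Z, ζ, π_u)` for the Smale space `S`: factor maps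
`π_s : Y → X`, `π_u : Z → X`, the first `s`-bijective with totally disconnected unstable sets upstairs,
the second `u`-bijective with totally disconnected stable sets upstairs. -/
structure SUBijectivePair {X : Type*} [MetricSpace X] [CompactSpace X] (S : SmaleSpace X)
    (Y Z : Type*) [MetricSpace Y] [CompactSpace Y] [MetricSpace Z] [CompactSpace Z] where
  SY : SmaleSpace Y
  SZ : SmaleSpace Z
  πs : Y → X
  πu : Z → X
  isMap_πs : SY.IsMap S πs
  isMap_πu : SZ.IsMap S πu
  surjective_πs : Function.Surjective πs
  surjective_πu : Function.Surjective πu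
  sBijective_πs : SY.SBijective S πs
  uBijective_πu : SZ.UBijective S πu
  totallyDisconnected_unstable :
    ∀ y, @IsTotallyDisconnected Y SY.unstableTopology (SY.globalUnstable y)
  totallyDisconnected_stable :
    ∀ z, @IsTotallyDisconnected Z SZ.stableTopology (SZ.globalStable z)

namespace SUBijectivePair

section Spaces

variable {X Y Z : Type*} [MetricSpace X] [CompactSpace X] [MetricSpace Y] [CompactSpace Y]
  [MetricSpace Z] [CompactSpace Z] {S : SmaleSpace X} (π : SUBijectivePair S Y Z)

/-- The space `Σ_{L,M}(π)`, with the maximum metric. -/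
abbrev Sig (L M : ℕ) : Type _ :=
  {p : (Fin (L + 1) → Y) × (Fin (M + 1) → Z) // ∀ l m, π.πs (p.1 l) = π.πu (p.2 m)}

instance (L M : ℕ) : CompactSpace (π.Sig L M) := by
  refine isCompact_iff_compactSpace.1 (IsClosed.isCompact ?_)
  have : {p : (Fin (L + 1) → Y) × (Fin (M + 1) → Z) | ∀ l m, π.πs (p.1 l) = π.πu (p.2 m)} =
      ⋂ l, ⋂ m, {p | π.πs (p.1 l) = π.πu (p.2 m)} := by
    ext p
    simp
  change IsClosed {p : (Fin (L + 1) → Y) × (Fin (M + 1) → Z) | ∀ l m, π.πs (p.1 l) = π.πu (p.2 m)}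
  rw [this]
  refine isClosed_iInter fun l => isClosed_iInter fun m => isClosed_eq ?_ ?_
  · exact π.isMap_πs.1.comp ((continuous_apply l).comp continuous_fst)
  · exact π.isMap_πu.1.comp ((continuous_apply m).comp continuous_snd)

theorem exists_scale : ∃ δ > 0, δ ≤ π.SY.ε ∧ δ ≤ π.SZ.ε ∧
    (∀ y y', dist y y' ≤ δ → π.πs (π.SY.bracket y y') = S.bracket (π.πs y) (π.πs y')) ∧
    (∀ z z', dist z z' ≤ δ → π.πu (π.SZ.bracket z z') = S.bracket (π.πu z) (π.πu z')) := by
  obtain ⟨a, ha, ha', h⟩ := π.SY.exists_bracket_map S π.isMap_πs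
  obtain ⟨b, hb, hb', h'⟩ := π.SZ.exists_bracket_map S π.isMap_πu
  exact ⟨min a b, lt_min ha hb, (min_le_left _ _).trans ha', (min_le_right _ _).trans hb',
    fun y y' hy => h y y' (hy.trans (min_le_left _ _)),
    fun z z' hz => h' z z' (hz.trans (min_le_right _ _))⟩

/-- A scale below which brackets are defined in `Y`, `Z` and preserved by `π_s`, `π_u`. -/
noncomputable def scale : ℝ := π.exists_scale.choose

/-- The product homeomorphism `ψ × ⋯ × ψ × ζ × ⋯ × ζ` on `Σ_{L,M}(π)`. -/
def sigHomeo (L M : ℕ) : π.Sig L M ≃ₜ π.Sig L M where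
  toFun p := ⟨(fun l => π.SY.φ (p.1.1 l), fun m => π.SZ.φ (p.1.2 m)), fun l m => by
    rw [π.isMap_πs.2, π.isMap_πu.2, p.2 l m]⟩
  invFun p := ⟨(fun l => π.SY.φ.symm (p.1.1 l), fun m => π.SZ.φ.symm (p.1.2 m)), fun l m => by
    apply S.φ.injective
    rw [← π.isMap_πs.2, ← π.isMap_πu.2]
    simpa using p.2 l m⟩
  left_inv p := by ext <;> simp
  right_inv p := by ext <;> simp
  continuous_toFun := by fun_prop
  continuous_invFun := by fun_prop

open Classical in
/-- The coordinatewise bracket on `Σ_{L,M}(π)` (with a dummy value for points that are not close). -/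
noncomputable def sigBracket (L M : ℕ) (p q : π.Sig L M) : π.Sig L M :=
  if h : ∀ l m, π.πs (π.SY.bracket (p.1.1 l) (q.1.1 l)) = π.πu (π.SZ.bracket (p.1.2 m) (q.1.2 m))
  then ⟨(fun l => π.SY.bracket (p.1.1 l) (q.1.1 l), fun m => π.SZ.bracket (p.1.2 m) (q.1.2 m)), h⟩
  else p

theorem dist_fst_le {L M : ℕ} (p q : π.Sig L M) (l : Fin (L + 1)) :
    dist (p.1.1 l) (q.1.1 l) ≤ dist p q :=
  (dist_le_pi_dist p.1.1 q.1.1 l).trans (le_max_left _ _)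

theorem dist_snd_le {L M : ℕ} (p q : π.Sig L M) (m : Fin (M + 1)) :
    dist (p.1.2 m) (q.1.2 m) ≤ dist p q :=
  (dist_le_pi_dist p.1.2 q.1.2 m).trans (le_max_right _ _)

theorem dist_le_of {L M : ℕ} (p q : π.Sig L M) {r : ℝ} (hr : 0 ≤ r)
    (h1 : ∀ l, dist (p.1.1 l) (q.1.1 l) ≤ r) (h2 : ∀ m, dist (p.1.2 m) (q.1.2 m) ≤ r) :
    dist p q ≤ r :=
  max_le ((dist_pi_le_iff hr).2 h1) ((dist_pi_le_iff hr).2 h2)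

theorem sigBracket_coe {L M : ℕ} {p q : π.Sig L M} (h : dist p q ≤ π.scale) :
    (π.sigBracket L M p q).1 =
      (fun l => π.SY.bracket (p.1.1 l) (q.1.1 l), fun m => π.SZ.bracket (p.1.2 m) (q.1.2 m)) := by
  have hs := π.exists_scale.choose_spec
  unfold sigBracket
  rw [dif_pos]
  intro l m
  rw [hs.2.2.2.1 _ _ ((π.dist_fst_le p q l).trans h),
    hs.2.2.2.2 _ _ ((π.dist_snd_le p q m).trans h), p.2 l m, q.2 l m]

/-- `Σ_{L,M}(π)` as a Smale space. -/
noncomputable def sig (L M : ℕ) : SmaleSpace (π.Sig L M) where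
  φ := π.sigHomeo L M
  ε := π.scale
  lam := max π.SY.lam π.SZ.lam
  bracket := π.sigBracket L M
  ε_pos := π.exists_scale.choose_spec.1
  lam_pos := lt_max_of_lt_left π.SY.lam_pos
  lam_lt_one := max_lt π.SY.lam_lt_one π.SZ.lam_lt_one
  continuousOn_bracket := by
    have hs := π.exists_scale.choose_spec
    refine (Topology.IsInducing.continuousOn_iff (g := fun p : π.Sig L M => p.1)
      Topology.IsInducing.subtypeVal).2 ?_
    refine ContinuousOn.congr (f := fun p : π.Sig L M × π.Sig L M =>
      ((fun l => π.SY.bracket (p.1.1.1 l) (p.2.1.1 l), fun m => π.SZ.bracket (p.1.1.2 m) (p.2.1.2 m)) :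
        (Fin (L + 1) → Y) × (Fin (M + 1) → Z))) ?_ (fun p hp => π.sigBracket_coe hp)
    refine ContinuousOn.prodMk (continuousOn_pi.2 fun l => ?_) (continuousOn_pi.2 fun m => ?_)
    · refine π.SY.continuousOn_bracket.comp
        (f := fun p : π.Sig L M × π.Sig L M => (p.1.1.1 l, p.2.1.1 l))
        (Continuous.continuousOn (by fun_prop)) ?_
      intro p hp
      exact (π.dist_fst_le p.1 p.2 l).trans (le_trans hp hs.2.1)
    · refine π.SZ.continuousOn_bracket.comp
        (f := fun p : π.Sig L M × π.Sig L M => (p.1.1.2 m, p.2.1.2 m))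
        (Continuous.continuousOn (by fun_prop)) ?_
      intro p hp
      exact (π.dist_snd_le p.1 p.2 m).trans (le_trans hp hs.2.2.1)
  B1 p := by
    have hs := π.exists_scale.choose_spec
    apply Subtype.ext
    rw [π.sigBracket_coe (by rw [dist_self]; exact hs.1.le)]
    simp only [π.SY.B1, π.SZ.B1]
  B2 x y z h1 h2 h3 := by
    have hs := π.exists_scale.choose_spec
    apply Subtype.ext
    have k1 := fun l => (π.dist_fst_le _ _ l).trans h2
    have k2 := fun m => (π.dist_snd_le _ _ m).trans h2
    rw [π.sigBracket_coe h2, π.sigBracket_coe h3]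
    rw [π.sigBracket_coe h1] at k1 k2 ⊢
    ext i
    · exact π.SY.B2 _ _ _ ((π.dist_fst_le _ _ i).trans (h1.trans hs.2.1)) ((k1 i).trans hs.2.1)
        ((π.dist_fst_le _ _ i).trans (h3.trans hs.2.1))
    · exact π.SZ.B2 _ _ _ ((π.dist_snd_le _ _ i).trans (h1.trans hs.2.2.1)) ((k2 i).trans hs.2.2.1)
        ((π.dist_snd_le _ _ i).trans (h3.trans hs.2.2.1))
  B3 x y z h1 h2 h3 := by
    have hs := π.exists_scale.choose_spec
    apply Subtype.ext
    have k1 := fun l => (π.dist_fst_le _ _ l).trans h2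
    have k2 := fun m => (π.dist_snd_le _ _ m).trans h2
    rw [π.sigBracket_coe h2, π.sigBracket_coe h3]
    rw [π.sigBracket_coe h1] at k1 k2 ⊢
    ext i
    · exact π.SY.B3 _ _ _ ((π.dist_fst_le _ _ i).trans (h1.trans hs.2.1)) ((k1 i).trans hs.2.1)
        ((π.dist_fst_le _ _ i).trans (h3.trans hs.2.1))
    · exact π.SZ.B3 _ _ _ ((π.dist_snd_le _ _ i).trans (h1.trans hs.2.2.1)) ((k2 i).trans hs.2.2.1)
        ((π.dist_snd_le _ _ i).trans (h3.trans hs.2.2.1))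
  B4 x y h1 h2 := by
    have hs := π.exists_scale.choose_spec
    apply Subtype.ext
    rw [π.sigBracket_coe h2]
    change _ = ((fun l => π.SY.φ ((π.sigBracket L M x y).1.1 l),
      fun m => π.SZ.φ ((π.sigBracket L M x y).1.2 m)) : (Fin (L + 1) → Y) × (Fin (M + 1) → Z))
    rw [π.sigBracket_coe h1]
    ext i
    · exact π.SY.B4 _ _ ((π.dist_fst_le _ _ i).trans (h1.trans hs.2.1))
        ((π.dist_fst_le _ _ i).trans (h2.trans hs.2.1))
    · exact π.SZ.B4 _ _ ((π.dist_snd_le _ _ i).trans (h1.trans hs.2.2.1))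
        ((π.dist_snd_le _ _ i).trans (h2.trans hs.2.2.1))
  C1 y z h hb := by
    have hs := π.exists_scale.choose_spec
    have hc := congrArg Subtype.val hb
    rw [π.sigBracket_coe h] at hc
    have hl : 0 ≤ max π.SY.lam π.SZ.lam := (lt_max_of_lt_left π.SY.lam_pos).le
    refine π.dist_le_of _ _ (mul_nonneg hl dist_nonneg) (fun l => ?_) (fun m => ?_)
    · refine (π.SY.C1 _ _ ((π.dist_fst_le _ _ l).trans (h.trans hs.2.1))
        (congrFun (congrArg Prod.fst hc) l)).trans ?_
      exact mul_le_mul (le_max_left _ _) (π.dist_fst_le _ _ l) dist_nonneg hl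
    · refine (π.SZ.C1 _ _ ((π.dist_snd_le _ _ m).trans (h.trans hs.2.2.1))
        (congrFun (congrArg Prod.snd hc) m)).trans ?_
      exact mul_le_mul (le_max_right _ _) (π.dist_snd_le _ _ m) dist_nonneg hl
  C2 y z h hb := by
    have hs := π.exists_scale.choose_spec
    have hc := congrArg Subtype.val hb
    rw [π.sigBracket_coe h] at hc
    have hl : 0 ≤ max π.SY.lam π.SZ.lam := (lt_max_of_lt_left π.SY.lam_pos).le
    refine π.dist_le_of _ _ (mul_nonneg hl dist_nonneg) (fun l => ?_) (fun m => ?_)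
    · refine (π.SY.C2 _ _ ((π.dist_fst_le _ _ l).trans (h.trans hs.2.1))
        (congrFun (congrArg Prod.fst hc) l)).trans ?_
      exact mul_le_mul (le_max_left _ _) (π.dist_fst_le _ _ l) dist_nonneg hl
    · refine (π.SZ.C2 _ _ ((π.dist_snd_le _ _ m).trans (h.trans hs.2.2.1))
        (congrFun (congrArg Prod.snd hc) m)).trans ?_
      exact mul_le_mul (le_max_right _ _) (π.dist_snd_le _ _ m) dist_nonneg hl

/-- The structure map `(y, z) ↦ (y ∘ α, z)` of the bisimplicial space, for `α : [L'] → [L]`. -/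
def reindexY {L L' : ℕ} (M : ℕ) (α : Fin (L' + 1) → Fin (L + 1)) (p : π.Sig L M) : π.Sig L' M :=
  ⟨(fun l => p.1.1 (α l), p.1.2), fun l m => p.2 (α l) m⟩

/-- The structure map `(y, z) ↦ (y, z ∘ β)` of the bisimplicial space, for `β : [M'] → [M]`. -/
def reindexZ (L : ℕ) {M M' : ℕ} (β : Fin (M' + 1) → Fin (M + 1)) (p : π.Sig L M) : π.Sig L M' :=
  ⟨(p.1.1, fun m => p.1.2 (β m)), fun l m => p.2 l (β m)⟩

/-- `δ_l : Σ_{L+1,M} → Σ_{L,M}` deletes `y_l`. -/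
def faceY (L M : ℕ) (l : Fin (L + 2)) : π.Sig (L + 1) M → π.Sig L M := π.reindexY M l.succAbove

/-- `s_l : Σ_{L,M} → Σ_{L+1,M}` repeats `y_l`. -/
def degenY (L M : ℕ) (l : Fin (L + 1)) : π.Sig L M → π.Sig (L + 1) M := π.reindexY M l.predAbove

/-- `δ_{,m} : Σ_{L,M+1} → Σ_{L,M}` deletes `z_m`. -/
def faceZ (L M : ℕ) (m : Fin (M + 2)) : π.Sig L (M + 1) → π.Sig L M := π.reindexZ L m.succAbove

/-- `s_{,m} : Σ_{L,M} → Σ_{L,M+1}` repeats `z_m`. -/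
def degenZ (L M : ℕ) (m : Fin (M + 1)) : π.Sig L M → π.Sig L (M + 1) := π.reindexZ L m.predAbove

/-- The map `D^s(Σ_{L,M}) → D^s(Σ_{L',M})` induced covariantly by `α : [L'] → [L]`. -/
noncomputable def covY {L L' : ℕ} (M : ℕ) (α : Fin (L' + 1) → Fin (L + 1)) :
    (π.sig L M).Ds →+ (π.sig L' M).Ds :=
  (π.sig L M).push (π.sig L' M) (π.reindexY M α)

/-- The map `D^s(Σ_{L,M'}) → D^s(Σ_{L,M})` induced contravariantly by `β : [M'] → [M]`. -/
noncomputable def conZ (L : ℕ) {M M' : ℕ} (β : Fin (M' + 1) → Fin (M + 1)) :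
    (π.sig L M').Ds →+ (π.sig L M).Ds :=
  (π.sig L M).pull (π.sig L M') (π.reindexZ L β)

/-- The laws saying that `[L], [M] ↦ D^s(Σ_{L,M})`, with the maps `covY` and `conZ`, is a functor
`Δᵒᵖ × Δ → Ab`. -/
structure DsFunctorial : Prop where
  covY_id : ∀ L M, π.covY M (id : Fin (L + 1) → Fin (L + 1)) = AddMonoidHom.id _
  covY_comp : ∀ {L L' L'' : ℕ} (M : ℕ) (α : Fin (L' + 1) →o Fin (L + 1))
    (α' : Fin (L'' + 1) →o Fin (L' + 1)), π.covY M (α ∘ α') = (π.covY M α').comp (π.covY M α)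
  conZ_id : ∀ L M, π.conZ L (id : Fin (M + 1) → Fin (M + 1)) = AddMonoidHom.id _
  conZ_comp : ∀ (L : ℕ) {M M' M'' : ℕ} (β : Fin (M' + 1) →o Fin (M + 1))
    (β' : Fin (M'' + 1) →o Fin (M' + 1)), π.conZ L (β ∘ β') = (π.conZ L β).comp (π.conZ L β')
  comm : ∀ {L L' M M' : ℕ} (α : Fin (L' + 1) →o Fin (L + 1)) (β : Fin (M' + 1) →o Fin (M + 1)),
    (π.covY M α).comp (π.conZ L β) = (π.conZ L' β).comp (π.covY M' α)

/-- The simplicial cosimplicial abelian group `D^s(Σ_{•,•}(π))`. -/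
noncomputable def dsObject (h : π.DsFunctorial) :
    SimplicialObject (CosimplicialObject AddCommGrpCat) where
  obj a :=
    { obj b := AddCommGrpCat.of (π.sig a.unop.len b.len).Ds
      map β := AddCommGrpCat.ofHom (π.conZ a.unop.len β.toOrderHom)
      map_id b := by
        apply AddCommGrpCat.hom_ext
        exact h.conZ_id _ _
      map_comp β β' := by
        apply AddCommGrpCat.hom_ext
        exact h.conZ_comp _ β'.toOrderHom β.toOrderHom }
  map α :=
    { app b := AddCommGrpCat.ofHom (π.covY b.len α.unop.toOrderHom)
      naturality b b' β := by
        apply AddCommGrpCat.hom_ext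
        exact h.comm α.unop.toOrderHom β.toOrderHom }
  map_id a := by
    apply NatTrans.ext
    funext b
    apply AddCommGrpCat.hom_ext
    exact h.covY_id _ _
  map_comp α α' := by
    apply NatTrans.ext
    funext b
    apply AddCommGrpCat.hom_ext
    exact h.covY_comp _ α.unop.toOrderHom α'.unop.toOrderHom

/-- `∂^s_{L+1,M} = ∑_l (-1)^l δ_l^s`. -/
noncomputable def dS (L M : ℕ) : (π.sig (L + 1) M).Ds →+ (π.sig L M).Ds :=
  ∑ l : Fin (L + 2), (-1 : ℤ) ^ (l : ℕ) •
    (π.sig (L + 1) M).push (π.sig L M) (π.faceY L M l)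

/-- `∂^{s*}_{L,M} = ∑_m (-1)^(L+m) δ_{,m}^{s*}`. -/
noncomputable def dSStar (L M : ℕ) : (π.sig L M).Ds →+ (π.sig L (M + 1)).Ds :=
  ∑ m : Fin (M + 2), (-1 : ℤ) ^ (L + (m : ℕ)) •
    (π.sig L (M + 1)).pull (π.sig L M) (π.faceZ L M m)

end Spaces

end SUBijectivePair

universe u

/-- A first-quadrant double complex of abelian groups, homological in the first and cohomological in
the second index, with anticommuting differentials (entries with a negative index are zero). -/
structure MixedDoubleComplex where
  obj : ℕ → ℕ → AddCommGrpCat.{u}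
  dh : ∀ L M, obj (L + 1) M ⟶ obj L M
  dv : ∀ L M, obj L M ⟶ obj L (M + 1)
  dh_dh : ∀ L M, dh (L + 1) M ≫ dh L M = 0
  dv_dv : ∀ L M, dv L M ≫ dv L (M + 1) = 0
  anticomm : ∀ L M, dh L M ≫ dv L M + dv (L + 1) M ≫ dh L (M + 1) = 0

noncomputable instance : Preadditive (CosimplicialObject AddCommGrpCat.{u}) :=
  inferInstanceAs (Preadditive (SimplexCategory ⥤ AddCommGrpCat.{u}))

theorem sign_aux_zero {C : Type*} [Category C] [Preadditive C] {a b c : C} (f : a ⟶ b) (g : b ⟶ c)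
    (h : f ≫ g = 0) (L : ℕ) : ((-1 : ℤ) ^ L • f) ≫ ((-1 : ℤ) ^ L • g) = 0 := by
  rw [Preadditive.zsmul_comp, Preadditive.comp_zsmul, h, smul_zero, smul_zero]

theorem sign_aux {C : Type*} [Category C] [Preadditive C] {a b c d : C} (f : a ⟶ b) (g : b ⟶ d)
    (f' : a ⟶ c) (g' : c ⟶ d) (h : f ≫ g = f' ≫ g') (L : ℕ) :
    f ≫ ((-1 : ℤ) ^ L • g) + ((-1 : ℤ) ^ (L + 1) • f') ≫ g' = 0 := by
  rw [Preadditive.zsmul_comp, Preadditive.comp_zsmul, h, pow_succ, mul_neg_one, neg_smul,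
    add_neg_cancel]

/-- The unnormalized double complex of a simplicial cosimplicial abelian group: the alternating sums of
faces in the simplicial direction and of cofaces in the cosimplicial direction, the latter multiplied by
`(-1)^L` in column `L` so that the two differentials anticommute. -/
noncomputable def unnormalizedDoubleComplex
    (F : SimplicialObject (CosimplicialObject AddCommGrpCat.{u})) : MixedDoubleComplex.{u} where
  obj L M := (F.obj (op (SimplexCategory.mk L))).obj (SimplexCategory.mk M)
  dh L M := (((AlgebraicTopology.alternatingFaceMapComplex _).obj F).d (L + 1) L).app
    (SimplexCategory.mk M)
  dv L M := (-1 : ℤ) ^ L • ((AlgebraicTopology.alternatingCofaceMapComplex _).obj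
    (F.obj (op (SimplexCategory.mk L)))).d M (M + 1)
  dh_dh L M := by
    have := ((AlgebraicTopology.alternatingFaceMapComplex _).obj F).d_comp_d (L + 2) (L + 1) L
    exact congrArg (fun f => NatTrans.app f (SimplexCategory.mk M)) this
  dv_dv L M := by
    have := ((AlgebraicTopology.alternatingCofaceMapComplex _).obj
      (F.obj (op (SimplexCategory.mk L)))).d_comp_d M (M + 1) (M + 2)
    exact sign_aux_zero _ _ this L
  anticomm L M := by
    have := ((AlgebraicTopology.alternatingCofaceMapComplex _).map
      (((AlgebraicTopology.alternatingFaceMapComplex _).obj F).d (L + 1) L)).comm M (M + 1)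
    exact sign_aux _ _ _ _ this L

namespace SUBijectivePair

section Complex

variable {X Y Z : Type*} [MetricSpace X] [CompactSpace X] [MetricSpace Y] [CompactSpace Y]
  [MetricSpace Z] [CompactSpace Z] {S : SmaleSpace X} (π : SUBijectivePair S Y Z)

/-- `(C_{L,M}, ∂^s, ∂^{s*})` is a double complex. -/
structure IsDoubleComplex : Prop where
  dS_dS : ∀ L M, (π.dS L M).comp (π.dS (L + 1) M) = 0
  dSStar_dSStar : ∀ L M, (π.dSStar L (M + 1)).comp (π.dSStar L M) = 0
  anticomm : ∀ L M,
    (π.dSStar L M).comp (π.dS L M) + (π.dS L (M + 1)).comp (π.dSStar (L + 1) M) = 0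

/-- Putnam's double complex `(C_{L,M}, ∂^s, ∂^{s*})`, `C_{L,M} = D^s(Σ_{L,M}(π))`. -/
noncomputable def putnamComplex (h : π.IsDoubleComplex) : MixedDoubleComplex where
  obj L M := AddCommGrpCat.of (π.sig L M).Ds
  dh L M := AddCommGrpCat.ofHom (π.dS L M)
  dv L M := AddCommGrpCat.ofHom (π.dSStar L M)
  dh_dh L M := by
    apply AddCommGrpCat.hom_ext
    exact h.dS_dS L M
  dv_dv L M := by
    apply AddCommGrpCat.hom_ext
    exact h.dSStar_dSStar L M
  anticomm L M := by
    apply AddCommGrpCat.hom_ext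
    exact h.anticomm L M

end Complex

end SUBijectivePair

/-! The proof studies what the two kinds of maps do to sets that are compact and open in the stable
topology. A set is compact there exactly when it is compact in the metric and flat, meaning that
close points of it lie in a common local stable set (`isCompact_stable_iff`). A compact open set is
a finite disjoint union of members of `CO^s`, and the sum of their classes depends only on the set
(`IsPartition.sum_eq`).

Covariant maps. On a stable set of `Σ_{L,M}` the `y`-coordinates are determined by the
`z`-coordinates, so `α^*` is `s`-bijective. Such a map is continuous and open for the stable
topologies; openness rests on `IsMap.exists_dist_iterate_lt`, which lifts closeness of forward
orbits. Moreover `α^*` does not increase distances and commutes with brackets at the scale shared by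
all `Σ_{L,M}`, so it preserves holonomic pairs.

Contravariant maps. Dually `β^*` is `u`-bijective, and preimages of compact open sets are compact
open (`CompOpen.preimage`). The main difficulty is invariance under holonomy
(`Holonomic.equidecomposable_preimage`). Holonomic sets `E`, `F` are matched by a homeomorphism
along local unstable sets. A power of `φ⁻¹` shrinks the displacement until the matching lifts
through `β^*`. Stable sets of `Σ_{L,M}` are totally disconnected, so the lifted graph, which is
compact, splits into small clopen pieces whose two projections are holonomic. The same power of `φ`
carries the pieces back.

Functoriality in each variable reduces to composition of images and of preimages. The two variables
commute by base change: `α^*` maps `(β^*)⁻¹(E)` bijectively onto `(β^*)⁻¹(α^*(E))`. The statement on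
double complexes is then formal. -/

namespace SmaleSpace

/-! ### The stable topology, flat sets and compact open sets -/

section LocalStructure

open Set Topology

variable {X : Type*} [MetricSpace X] [CompactSpace X] (S : SmaleSpace X)

/-- `y` and `z` are close and lie in the same local stable set. -/
def LocS (y z : X) : Prop := dist y z ≤ S.ε ∧ S.bracket y z = z

variable {S}

theorem LocS.symm {y z : X} (h : S.LocS y z) : S.LocS z y := by
  refine ⟨by rw [dist_comm]; exact h.1, ?_⟩
  have := S.B3 y z y h.1 (by rw [h.2, dist_comm]; exact h.1) (by simpa using S.ε_pos.le)
  rwa [h.2, S.B1] at this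

theorem LocS.trans {x y z : X} (h : S.LocS x y) (h' : S.LocS y z) (hd : dist x z ≤ S.ε) :
    S.LocS x z := by
  refine ⟨hd, ?_⟩
  have := S.B3 x y z h.1 (by rw [h.2]; exact h'.1) hd
  rw [← this, h.2, h'.2]

theorem mem_localStable {x y : X} {δ : ℝ} (hδ : δ ≤ S.ε) :
    y ∈ S.localStable x δ ↔ dist x y < δ ∧ S.LocS x y := by
  constructor
  · rintro ⟨h1, h2⟩
    exact ⟨h1, LocS.symm ⟨by rw [dist_comm]; exact h1.le.trans hδ, h2⟩⟩
  · rintro ⟨h1, h2⟩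
    exact ⟨h1, h2.symm.2⟩

theorem LocS.φ {y z : X} (h : S.LocS y z) : S.LocS (S.φ y) (S.φ z) := by
  have h1 : dist (S.φ y) (S.φ z) ≤ S.ε := (S.C1 y z h.1 h.2).trans
    ((mul_le_of_le_one_left dist_nonneg S.lam_lt_one.le).trans h.1)
  exact ⟨h1, by rw [S.B4 _ _ h.1 h1, h.2]⟩

theorem LocS.mem_globalStable {y z : X} (h : S.LocS y z) : z ∈ S.globalStable y := by
  have hlim : Filter.Tendsto (fun n : ℕ => S.lam ^ n * dist y z) Filter.atTop (𝓝 (0 * dist y z)) :=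
    (tendsto_pow_atTop_nhds_zero_of_lt_one S.lam_pos.le S.lam_lt_one).mul_const _
  rw [zero_mul] at hlim
  exact squeeze_zero (fun _ => dist_nonneg) (fun n => (S.stable_iterate h.1 h.2 n).1) hlim

/-- The bracket of close points lies in the stable set of the first. -/
theorem LocS.of_bracket {x y : X} (h : dist x y ≤ S.ε) (h1 : dist x (S.bracket x y) ≤ S.ε) :
    S.LocS x (S.bracket x y) :=
  ⟨h1, S.B2 _ _ _ h h1 h⟩

theorem mem_globalStable_self (x : X) : x ∈ S.globalStable x := by
  simp [globalStable]

theorem mem_globalStable_symm {x y : X} (h : y ∈ S.globalStable x) : x ∈ S.globalStable y := by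
  simpa only [globalStable, mem_ofPred_eq, dist_comm] using h

theorem mem_globalStable_trans {x y z : X} (h : y ∈ S.globalStable x) (h' : z ∈ S.globalStable y) :
    z ∈ S.globalStable x := by
  have := Filter.Tendsto.add h h'
  rw [add_zero] at this
  exact squeeze_zero (fun _ => dist_nonneg) (fun n => dist_triangle _ _ _) this

theorem globalStable_eq {x y : X} (h : y ∈ S.globalStable x) :
    S.globalStable y = S.globalStable x :=
  Subset.antisymm (fun _ hz => mem_globalStable_trans h hz)
    fun _ hz => mem_globalStable_trans (mem_globalStable_symm h) hz

theorem localStable_subset {x : X} {δ : ℝ} (hδ : δ ≤ S.ε) :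
    S.localStable x δ ⊆ S.globalStable x :=
  fun _ hy => ((mem_localStable hδ).1 hy).2.mem_globalStable

theorem mem_localStable_self (x : X) {δ : ℝ} (hδ : 0 < δ) : x ∈ S.localStable x δ :=
  ⟨by simpa using hδ, S.B1 x⟩

theorem localStable_mono (x : X) {δ δ' : ℝ} (h : δ ≤ δ') :
    S.localStable x δ ⊆ S.localStable x δ' :=
  fun _ hy => ⟨hy.1.trans_le h, hy.2⟩

theorem exists_localStable_subset {x y : X} {δ : ℝ} (hδ : δ ≤ S.ε) (hy : y ∈ S.localStable x δ) :
    ∃ δ' > 0, δ' ≤ S.ε ∧ S.localStable y δ' ⊆ S.localStable x δ := by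
  refine ⟨δ - dist x y, sub_pos.2 hy.1, (sub_le_self _ dist_nonneg).trans hδ, fun w hw => ?_⟩
  have h1 := (mem_localStable hδ).1 hy
  have h2 := (mem_localStable ((sub_le_self _ dist_nonneg).trans hδ)).1 hw
  have h3 : dist x w < δ := by linarith [dist_triangle x y w, h2.1]
  exact (mem_localStable hδ).2 ⟨h3, h1.2.trans h2.2 (h3.le.trans hδ)⟩

/-- A local stable set contains a smaller one around each of its points, so these sets form a base
and not just a subbase. -/
theorem isOpen_stable_iff {U : Set X} : IsOpen[S.stableTopology] U ↔
    ∀ x ∈ U, ∃ δ > 0, δ ≤ S.ε ∧ S.localStable x δ ⊆ U := by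
  constructor
  · intro h
    induction h with
    | basic s hs =>
      obtain ⟨x, δ, h1, h2, rfl⟩ := hs
      exact fun y hy => exists_localStable_subset h2 hy
    | univ => exact fun x _ => ⟨S.ε, S.ε_pos, le_rfl, subset_univ _⟩
    | inter s t _ _ h1 h2 =>
      rintro x ⟨hs, ht⟩
      obtain ⟨a, ha, ha', h⟩ := h1 x hs
      obtain ⟨b, hb, hb', h'⟩ := h2 x ht
      exact ⟨min a b, lt_min ha hb, (min_le_left _ _).trans ha', subset_inter
        ((localStable_mono x (min_le_left _ _)).trans h)
        ((localStable_mono x (min_le_right _ _)).trans h')⟩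
    | sUnion T _ ih =>
      rintro x ⟨s, hs, hx⟩
      obtain ⟨a, ha, ha', h⟩ := ih s hs x hx
      exact ⟨a, ha, ha', h.trans (subset_sUnion_of_mem hs)⟩
  · intro h
    let := S.stableTopology
    rw [isOpen_iff_forall_mem_open]
    intro x hx
    obtain ⟨δ, h1, h2, h3⟩ := h x hx
    exact ⟨_, h3, TopologicalSpace.isOpen_generateFrom_of_mem ⟨x, δ, h1, h2, rfl⟩,
      mem_localStable_self x h1⟩

theorem isOpen_localStable (x : X) {δ : ℝ} (hδ : δ ≤ S.ε) :
    IsOpen[S.stableTopology] (S.localStable x δ) :=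
  isOpen_stable_iff.2 fun _ hy => exists_localStable_subset hδ hy

theorem stableTopology_le : S.stableTopology ≤ (inferInstance : TopologicalSpace X) := by
  intro U hU
  rw [isOpen_stable_iff]
  intro x hx
  obtain ⟨δ, hδ, h⟩ := Metric.isOpen_iff.1 hU x hx
  refine ⟨min δ S.ε, lt_min hδ S.ε_pos, min_le_right _ _, fun y hy => h ?_⟩
  rw [Metric.mem_ball, dist_comm]
  exact hy.1.trans_le (min_le_left _ _)

theorem t2Space_stable : @T2Space X S.stableTopology :=
  @T2Space.of_injective_continuous X X S.stableTopology _ _ id Function.injective_id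
    (continuous_id_of_le stableTopology_le)

theorem isOpen_globalStable (x : X) : IsOpen[S.stableTopology] (S.globalStable x) := by
  rw [isOpen_stable_iff]
  intro y hy
  refine ⟨S.ε, S.ε_pos, le_rfl, fun z hz => ?_⟩
  exact mem_globalStable_trans hy (localStable_subset le_rfl hz)

/-- The stable sets are open and partition the space, so each is the complement of a union of open
sets. -/
theorem isClosed_globalStable (x : X) : IsClosed[S.stableTopology] (S.globalStable x) := by
  let := S.stableTopology
  rw [← isOpen_compl_iff, isOpen_stable_iff]
  intro y hy
  refine ⟨S.ε, S.ε_pos, le_rfl, fun z hz hz' => hy ?_⟩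
  exact mem_globalStable_trans hz' (mem_globalStable_symm (localStable_subset le_rfl hz))

variable (S) in
/-- Nearby points of `E` are in the same local stable set. -/
def Flat (E : Set X) : Prop := ∃ δ > 0, ∀ x ∈ E, ∀ y ∈ E, dist x y ≤ δ → S.LocS x y

theorem Flat.mono {E F : Set X} (h : S.Flat F) (hE : E ⊆ F) : S.Flat E := by
  obtain ⟨δ, hδ, h⟩ := h
  exact ⟨δ, hδ, fun x hx y hy => h x (hE hx) y (hE hy)⟩

theorem isCompact_of_stable {E : Set X} (h : @IsCompact X S.stableTopology E) : IsCompact E := by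
  have := @IsCompact.image X X S.stableTopology _ E id h (continuous_id_of_le stableTopology_le)
  simpa using this

theorem flat_of_isCompact_stable {E : Set X} (h : @IsCompact X S.stableTopology E) : S.Flat E := by
  have key : ∃ δ > 0, ∀ x ∈ E, ∀ x' ∈ E, dist x x' ≤ δ → S.LocS x x' := by
    -- Only the first point is confined to `N`; the second ranges over all of `E`, which makes the
    -- property pass to unions.
    refine @IsCompact.induction_on X S.stableTopology E h
      (p := fun N => ∃ δ > 0, ∀ x ∈ N, ∀ x' ∈ E, dist x x' ≤ δ → S.LocS x x') ?_ ?_ ?_ ?_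
    · exact ⟨1, one_pos, by simp⟩
    · rintro s t hst ⟨δ, hδ, h⟩
      exact ⟨δ, hδ, fun x hx => h x (hst hx)⟩
    · rintro s t ⟨δ, hδ, h⟩ ⟨δ', hδ', h'⟩
      refine ⟨min δ δ', lt_min hδ hδ', ?_⟩
      rintro x (hx | hx) x' hx' hd
      · exact h x hx x' hx' (hd.trans (min_le_left _ _))
      · exact h' x hx x' hx' (hd.trans (min_le_right _ _))
    · intro x hx
      have hε := S.ε_pos
      -- The part of `E` off the local stable set of `x` is stably compact, hence closed in the
      -- metric, so some metric ball around `x` misses it.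
      have hK : @IsCompact X S.stableTopology (E \ S.localStable x (S.ε / 2)) :=
        @IsCompact.diff X S.stableTopology _ _ h (isOpen_localStable x (by linarith))
      have hK' := (isCompact_of_stable hK).isClosed
      have hxK : x ∈ (E \ S.localStable x (S.ε / 2))ᶜ :=
        fun h => h.2 (mem_localStable_self x (by linarith))
      obtain ⟨ρ, hρ, hb⟩ := Metric.isOpen_iff.1 hK'.isOpen_compl x hxK
      have hm1 := min_le_left (S.ε / 2) (ρ / 2)
      have hm2 := min_le_right (S.ε / 2) (ρ / 2)
      refine ⟨S.localStable x (min (S.ε / 2) (ρ / 2)), @mem_nhdsWithin_of_mem_nhds X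
        S.stableTopology _ _ _ (@IsOpen.mem_nhds X S.stableTopology _ _
          (isOpen_localStable x (by linarith))
          (mem_localStable_self x (lt_min (by linarith) (by linarith)))), ρ / 2, by linarith, ?_⟩
      intro x' hx' y hy hd
      have h2 := (mem_localStable (by linarith)).1 hx'
      have h3 : y ∈ S.localStable x (S.ε / 2) := by
        by_contra hcon
        refine hb ?_ ⟨hy, hcon⟩
        rw [Metric.mem_ball, dist_comm]
        linarith [dist_triangle x x' y]
      rw [mem_localStable (by linarith)] at h3
      refine h2.2.symm.trans h3.2 ?_
      have := dist_triangle x' x y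
      rw [dist_comm x' x] at this
      linarith
  exact key

/-- On flat sets the stable topology is not finer than the metric topology. -/
theorem Flat.continuousOn {E : Set X} (h : S.Flat E) :
    @ContinuousOn X X _ S.stableTopology id E := by
  obtain ⟨δ, hδ, h⟩ := h
  intro x hx
  refine Filter.tendsto_def.2 fun U hU => ?_
  obtain ⟨V, hVU, hV, hxV⟩ := (@mem_nhds_iff X S.stableTopology x U).1 hU
  obtain ⟨η, hη, hη', hηV⟩ := isOpen_stable_iff.1 hV x hxV
  rw [Metric.mem_nhdsWithin_iff]
  refine ⟨min δ η, lt_min hδ hη, ?_⟩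
  rintro y ⟨hy, hyE⟩
  rw [Metric.mem_ball, dist_comm] at hy
  refine hVU (hηV ((mem_localStable hη').2 ⟨hy.trans_le (min_le_right _ _), ?_⟩))
  exact h x hx y hyE (hy.le.trans (min_le_left _ _))

/-- On a flat set the metric and stable topologies coincide. This turns stable compactness into two
conditions that can be checked on preimages. -/
theorem isCompact_stable_iff {E : Set X} :
    @IsCompact X S.stableTopology E ↔ IsCompact E ∧ S.Flat E := by
  refine ⟨fun h => ⟨isCompact_of_stable h, flat_of_isCompact_stable h⟩, fun h => ?_⟩
  have := @IsCompact.image_of_continuousOn X X _ S.stableTopology E id h.1 h.2.continuousOn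
  simpa using this

variable (S) in
/-- Sets that are compact and open in the stable topology; they are finite unions of members
of `CO^s`. -/
def CompOpen (W : Set X) : Prop :=
  @IsCompact X S.stableTopology W ∧ @IsOpen X S.stableTopology W

theorem CompOpen.inter {V W : Set X} (hV : S.CompOpen V) (hW : S.CompOpen W) :
    S.CompOpen (V ∩ W) :=
  ⟨@IsCompact.inter X S.stableTopology t2Space_stable _ _ hV.1 hW.1,
    @IsOpen.inter X S.stableTopology _ _ hV.2 hW.2⟩

theorem CompOpen.isClosed {V : Set X} (hV : S.CompOpen V) : IsClosed[S.stableTopology] V :=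
  @IsCompact.isClosed X S.stableTopology t2Space_stable V hV.1

theorem CompOpen.diff {V W : Set X} (hV : S.CompOpen V) (hW : S.CompOpen W) :
    S.CompOpen (V \ W) :=
  ⟨@IsCompact.diff X S.stableTopology V W hV.1 hW.2,
    @IsOpen.sdiff X V W S.stableTopology hV.2 hW.isClosed⟩

theorem CompOpen.inter_globalStable {V : Set X} (hV : S.CompOpen V) (x : X) :
    S.CompOpen (V ∩ S.globalStable x) :=
  ⟨@IsCompact.inter_right X S.stableTopology V _ hV.1 (isClosed_globalStable x),
    @IsOpen.inter X S.stableTopology V _ hV.2 (isOpen_globalStable x)⟩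

/-- A relatively clopen subset of a compact open set is compact open. -/
theorem CompOpen.of_clopen {W V C D : Set X} (hW : S.CompOpen W) (hC : IsClosed C)
    (hD : IsClosed D) (hV : V = W ∩ C) (hVD : W \ V = W ∩ D) : S.CompOpen V := by
  have h : ∀ C, IsClosed C → @IsCompact X S.stableTopology (W ∩ C) := fun C hC =>
    @IsCompact.inter_right X S.stableTopology W C hW.1 (hC.mono stableTopology_le)
  refine ⟨hV ▸ h C hC, ?_⟩
  -- Openness of `V` comes from removing the stably compact, hence stably closed, set `W ∩ D` from
  -- the open set `W`.
  have h1 : V = W \ (W ∩ D) := by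
    rw [← hVD, sdiff_sdiff_cancel_left]
    rw [hV]
    exact inter_subset_left
  rw [h1]
  exact @IsOpen.sdiff X W _ S.stableTopology hW.2
    (@IsCompact.isClosed X S.stableTopology t2Space_stable _ (h D hD))

theorem CO.compOpen (E : S.CO) : S.CompOpen E.1 := E.2.2

/-- The restriction of `E ∈ CO^s` to a compact open subset. -/
def CO.restrict (E : S.CO) (V : Set X) (hV : S.CompOpen V) (h : V ⊆ E.1) : S.CO :=
  ⟨V, E.2.1.imp fun _ he => h.trans he, hV⟩

end LocalStructure

/-! ### Partitions into members of `CO^s` and homomorphisms out of `D^s` -/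

section Partitions

open Set Topology

variable {X : Type*} [MetricSpace X] [CompactSpace X] {S : SmaleSpace X}

variable (S) in
/-- `P` is a partition of `W` into members of `CO^s`. -/
def IsPartition (W : Set X) {ι : Type*} (P : ι → S.CO) : Prop :=
  (∀ i j, i ≠ j → Disjoint (P i).1 (P j).1) ∧ (⋃ i, (P i).1) = W

/-- Stable sets are open and pairwise equal or disjoint, so a compact set meets only finitely many
of them. -/
theorem CompOpen.exists_isPartition {W : Set X} (hW : S.CompOpen W) :
    ∃ (n : ℕ) (P : Fin n → S.CO), S.IsPartition W P := by
  classical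
  obtain ⟨t, ht⟩ := @IsCompact.elim_finite_subcover X S.stableTopology W X hW.1
    (fun x => S.globalStable x) isOpen_globalStable
    (fun x _ => mem_iUnion.2 ⟨x, mem_globalStable_self x⟩)
  -- Indexing by the stable sets themselves identifies points of `t` with the same stable set, which
  -- keeps the pieces disjoint.
  let T := t.image fun x => S.globalStable x
  have hT : ∀ ℓ ∈ T, ∃ x, S.globalStable x = ℓ := fun ℓ hℓ => by
    obtain ⟨x, -, hx⟩ := Finset.mem_image.1 hℓ
    exact ⟨x, hx⟩
  have hP : ∀ ℓ : T, (∃ e, W ∩ ℓ.1 ⊆ S.globalStable e) ∧ S.CompOpen (W ∩ ℓ.1) := by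
    intro ℓ
    obtain ⟨x, hx⟩ := hT ℓ.1 ℓ.2
    rw [← hx]
    exact ⟨⟨x, inter_subset_right⟩, hW.inter_globalStable x⟩
  refine ⟨_, fun i => ⟨W ∩ (T.equivFin.symm i).1, (hP _).1, (hP _).2⟩, ?_, ?_⟩
  · intro i j hij
    have hne : (T.equivFin.symm i).1 ≠ (T.equivFin.symm j).1 := fun h =>
      hij (T.equivFin.symm.injective (Subtype.ext h))
    obtain ⟨x, hx⟩ := hT _ (T.equivFin.symm i).2
    obtain ⟨y, hy⟩ := hT _ (T.equivFin.symm j).2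
    rw [Set.disjoint_left]
    rintro z ⟨-, hz⟩ ⟨-, hz'⟩
    rw [← hx] at hz hne
    rw [← hy] at hz' hne
    exact hne ((globalStable_eq hz).symm.trans (globalStable_eq hz'))
  · refine Subset.antisymm (iUnion_subset fun i => inter_subset_left) fun z hz => ?_
    obtain ⟨x, hx, hzx⟩ := mem_iUnion₂.1 (ht hz)
    refine mem_iUnion.2 ⟨T.equivFin ⟨_, Finset.mem_image_of_mem _ hx⟩, hz, ?_⟩
    simpa using hzx

theorem cls_eq_of_rel {E F : S.CO} (h : S.Rel E F) : S.cls E = S.cls F := by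
  have : (Quotient.mk S.relSetoid E) = Quotient.mk S.relSetoid F := Quotient.sound h
  simp only [cls, freeCls, this]

theorem cls_union {E F G : S.CO} (hd : Disjoint E.1 F.1) (hG : G.1 = E.1 ∪ F.1) :
    S.cls G = S.cls E + S.cls F := by
  have h : S.freeCls G - S.freeCls E - S.freeCls F ∈ S.additivity :=
    AddSubgroup.subset_closure ⟨E, F, G, hd, hG, rfl⟩
  have := (QuotientAddGroup.eq_zero_iff _).2 h
  rw [QuotientAddGroup.mk_sub, QuotientAddGroup.mk_sub, sub_sub, sub_eq_zero] at this
  exact this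

/-- The empty set is the disjoint union of itself with itself. -/
theorem cls_empty {E : S.CO} (h : E.1 = ∅) : S.cls E = 0 := by
  have := cls_union (E := E) (F := E) (G := E) (by simp [h]) (by simp)
  simpa using this

theorem cls_eq_sum_finset {ι : Type*} (P : ι → S.CO) (s : Finset ι)
    (hP : ∀ i ∈ s, ∀ j ∈ s, i ≠ j → Disjoint (P i).1 (P j).1) :
    ∀ E : S.CO, E.1 = ⋃ i ∈ s, (P i).1 → S.cls E = ∑ i ∈ s, S.cls (P i) := by
  classical
  induction s using Finset.induction_on with
  | empty =>
    intro E hE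
    rw [Finset.sum_empty]
    exact cls_empty (by simpa using hE)
  | insert a s ha ih =>
    intro E hE
    rw [Finset.set_biUnion_insert] at hE
    have hd : Disjoint (P a).1 (⋃ i ∈ s, (P i).1) := by
      rw [disjoint_iUnion₂_right]
      intro i hi
      exact hP a (Finset.mem_insert_self _ _) i (Finset.mem_insert_of_mem hi)
        fun h => ha (h ▸ hi)
    have hE' : (⋃ i ∈ s, (P i).1) = E.1 \ (P a).1 := by
      rw [hE, union_sdiff_left, hd.symm.sdiff_eq_left]
    let E' := E.restrict (⋃ i ∈ s, (P i).1) (hE' ▸ E.compOpen.diff (P a).compOpen)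
      (hE ▸ subset_union_right)
    rw [Finset.sum_insert ha, cls_union (E := P a) (F := E') hd hE]
    congr 1
    exact ih (fun i hi j hj => hP i (Finset.mem_insert_of_mem hi) j (Finset.mem_insert_of_mem hj))
      E' rfl

theorem IsPartition.cls_eq {ι : Type*} [Fintype ι] {P : ι → S.CO} {E : S.CO}
    (h : S.IsPartition E.1 P) : S.cls E = ∑ i, S.cls (P i) :=
  cls_eq_sum_finset P Finset.univ (fun i _ j _ => h.1 i j) E (by simpa using h.2.symm)

/-- The sum of the classes of the members of a partition depends only on the union. -/
theorem IsPartition.sum_eq {ι κ : Type*} [Fintype ι] [Fintype κ] {W : Set X} {P : ι → S.CO}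
    {Q : κ → S.CO} (hP : S.IsPartition W P) (hQ : S.IsPartition W Q) :
    ∑ i, S.cls (P i) = ∑ j, S.cls (Q j) := by
  -- The common refinement: both sums equal the double sum over `R`.
  let R : ι → κ → S.CO := fun i j =>
    (P i).restrict ((P i).1 ∩ (Q j).1) ((P i).compOpen.inter (Q j).compOpen) inter_subset_left
  have h1 : ∀ i, S.IsPartition (P i).1 (R i) := fun i => by
    refine ⟨fun j j' hj => (hQ.1 j j' hj).mono inter_subset_right inter_subset_right, ?_⟩
    change ⋃ j, (P i).1 ∩ (Q j).1 = _
    rw [← inter_iUnion, hQ.2, inter_eq_left, ← hP.2]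
    exact subset_iUnion (fun i => (P i).1) i
  have h2 : ∀ j, S.IsPartition (Q j).1 (fun i => R i j) := fun j => by
    refine ⟨fun i i' hi => (hP.1 i i' hi).mono inter_subset_left inter_subset_left, ?_⟩
    change ⋃ i, (P i).1 ∩ (Q j).1 = _
    rw [← iUnion_inter, hP.2, inter_eq_right, ← hQ.2]
    exact subset_iUnion (fun i => (Q i).1) j
  rw [Finset.sum_congr rfl fun i _ => (h1 i).cls_eq, Finset.sum_comm]
  exact Finset.sum_congr rfl fun j _ => (h2 j).cls_eq.symm

/-- A partition of the members of a partition. -/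
theorem IsPartition.sigma {ι : Type*} {κ : ι → Type*} {W : Set X} {V : ι → Set X}
    {Q : (i : ι) → κ i → S.CO} (hd : ∀ i j, i ≠ j → Disjoint (V i) (V j)) (hu : ⋃ i, V i = W)
    (hQ : ∀ i, S.IsPartition (V i) (Q i)) :
    S.IsPartition W (fun x : Σ i, κ i => Q x.1 x.2) := by
  have hsub : ∀ i k, (Q i k).1 ⊆ V i := fun i k => by
    rw [← (hQ i).2]
    exact subset_iUnion (fun k => (Q i k).1) k
  constructor
  · rintro ⟨i, k⟩ ⟨j, l⟩ h
    rcases eq_or_ne i j with rfl | hij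
    · exact (hQ i).1 k l fun hkl => h (by rw [hkl])
    · exact (hd i j hij).mono (hsub i k) (hsub j l)
  · rw [iUnion_sigma, ← hu]
    exact iUnion_congr fun i => (hQ i).2

theorem Ds_hom_ext {G : Type*} [AddCommGroup G] {g h : S.Ds →+ G}
    (H : ∀ E, g (S.cls E) = h (S.cls E)) : g = h := by
  apply QuotientAddGroup.addMonoidHom_ext
  apply FreeAbelianGroup.lift_ext
  intro q
  induction q using Quotient.inductionOn with
  | _ E => exact H E

/-- An additive invariant of `∼`-classes extends to the dimension group. -/
theorem exists_Ds_hom {G : Type*} [AddCommGroup G] (c : S.CO → G)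
    (hrel : ∀ E F, S.Rel E F → c E = c F)
    (hadd : ∀ E F H : S.CO, Disjoint E.1 F.1 → H.1 = E.1 ∪ F.1 → c H = c E + c F) :
    ∃ g : S.Ds →+ G, ∀ E, g (S.cls E) = c E := by
  let g₀ : FreeAbelianGroup (Quotient S.relSetoid) →+ G :=
    FreeAbelianGroup.lift (Quotient.lift c hrel)
  have hg₀ : ∀ E, g₀ (S.freeCls E) = c E := fun E => FreeAbelianGroup.lift_apply_of _ _
  refine ⟨QuotientAddGroup.lift S.additivity g₀ ?_, fun E => hg₀ E⟩
  rw [additivity, AddSubgroup.closure_le]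
  rintro _ ⟨E, F, H, hd, hH, rfl⟩
  change g₀ _ = 0
  rw [map_sub, map_sub, hg₀, hg₀, hg₀, hadd E F H hd hH]
  abel

end Partitions

end SmaleSpace

namespace SmaleSpace

/-! ### Maps of Smale spaces, lifting of closeness, and the covariant homomorphism -/

section MapLemmas

open Set Topology

theorem exists_dist_lt_of_continuous {A B : Type*} [MetricSpace A]
    [CompactSpace A] [MetricSpace B] {f : A → B} (hf : Continuous f) {η : ℝ} (hη : 0 < η) :
    ∃ δ > 0, ∀ x y, dist x y < δ → dist (f x) (f y) < η := by
  obtain ⟨δ, hδ, h⟩ := Metric.uniformContinuous_iff.1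
    (CompactSpace.uniformContinuous_of_continuous hf) η hη
  exact ⟨δ, hδ, fun x y hd => h hd⟩

variable {A B : Type*} [MetricSpace A] [CompactSpace A] [MetricSpace B] [CompactSpace B]
  {S : SmaleSpace A} {T : SmaleSpace B} {f : A → B}

theorem IsMap.iterate (hf : S.IsMap T f) (n : ℕ) (x : A) : f (S.φ^[n] x) = T.φ^[n] (f x) :=
  (Function.Semiconj.iterate_right (f := f) (ga := S.φ) (gb := T.φ) hf.2 n) x

theorem IsMap.inv (hf : S.IsMap T f) : S.inv.IsMap T.inv f := by
  refine ⟨hf.1, fun x => T.φ.injective ?_⟩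
  change T.φ (f (S.φ.symm x)) = T.φ (T.φ.symm (f x))
  rw [← hf.2]
  simp

theorem isMap_φ (S : SmaleSpace A) : S.IsMap S S.φ := ⟨S.φ.continuous, fun _ => rfl⟩

theorem isMap_φ_symm (S : SmaleSpace A) : S.IsMap S S.φ.symm :=
  ⟨S.φ.symm.continuous, fun x => by simp⟩

theorem IsMap.mem_globalStable (hf : S.IsMap T f) {x y : A} (h : y ∈ S.globalStable x) :
    f y ∈ T.globalStable (f x) := by
  refine Metric.tendsto_atTop.2 fun η hη => ?_
  obtain ⟨δ, hδ, hc⟩ := exists_dist_lt_of_continuous hf.1 hη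
  obtain ⟨N, hN⟩ := Metric.tendsto_atTop.1 h δ hδ
  refine ⟨N, fun n hn => ?_⟩
  have h1 := hN n hn
  rw [Real.dist_0_eq_abs, abs_of_nonneg dist_nonneg] at h1 ⊢
  rw [← hf.iterate, ← hf.iterate]
  exact hc _ _ h1

theorem IsMap.exists_locS (hf : S.IsMap T f) :
    ∃ δ > 0, δ ≤ S.ε ∧ ∀ x y, dist x y < δ → S.LocS x y → T.LocS (f x) (f y) := by
  obtain ⟨δ, hδ, hδ', h⟩ := S.exists_bracket_map T hf
  obtain ⟨δ₂, hδ₂, hc⟩ := exists_dist_lt_of_continuous hf.1 T.ε_pos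
  refine ⟨min δ δ₂, lt_min hδ hδ₂, (min_le_left _ _).trans hδ', fun x y hd hl => ⟨?_, ?_⟩⟩
  · exact (hc _ _ (hd.trans_le (min_le_right _ _))).le
  · rw [← h _ _ (hd.le.trans (min_le_left _ _)), hl.2]

theorem IsMap.isOpen_preimage (hf : S.IsMap T f) {U : Set B} (hU : IsOpen[T.stableTopology] U) :
    IsOpen[S.stableTopology] (f ⁻¹' U) := by
  rw [isOpen_stable_iff] at hU ⊢
  intro x hx
  obtain ⟨η, hη, hη', h⟩ := hU _ hx
  obtain ⟨δ, hδ, hδ', hl⟩ := hf.exists_locS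
  obtain ⟨δ₂, hδ₂, hc⟩ := exists_dist_lt_of_continuous hf.1 hη
  refine ⟨min δ δ₂, lt_min hδ hδ₂, (min_le_left _ _).trans hδ', fun y hy => h ?_⟩
  rw [mem_localStable ((min_le_left _ _).trans hδ')] at hy
  rw [mem_localStable hη']
  exact ⟨hc _ _ (hy.1.trans_le (min_le_right _ _)), hl _ _ (hy.1.trans_le (min_le_left _ _)) hy.2⟩

theorem IsMap.continuous_stable (hf : S.IsMap T f) :
    @Continuous A B S.stableTopology T.stableTopology f :=
  (@continuous_def A B S.stableTopology T.stableTopology f).2 fun _ => hf.isOpen_preimage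

theorem IsMap.isCompact_image (hf : S.IsMap T f) {V : Set A}
    (hV : @IsCompact A S.stableTopology V) : @IsCompact B T.stableTopology (f '' V) :=
  @IsCompact.image A B S.stableTopology T.stableTopology V f hV hf.continuous_stable

theorem CompOpen.image_φ {V : Set A} (hV : S.CompOpen V) : S.CompOpen (S.φ '' V) := by
  refine ⟨S.isMap_φ.isCompact_image hV.1, ?_⟩
  have := S.isMap_φ_symm.isOpen_preimage hV.2
  rwa [← S.φ.image_eq_preimage_symm] at this

theorem CompOpen.image_φ_symm {V : Set A} (hV : S.CompOpen V) : S.CompOpen (S.φ.symm '' V) := by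
  refine ⟨S.isMap_φ_symm.isCompact_image hV.1, ?_⟩
  have := S.isMap_φ.isOpen_preimage hV.2
  rw [S.φ.symm.image_eq_preimage_symm]
  exact this

/-- The action of `φ` on `CO^s`. -/
def CO.φ (E : S.CO) : S.CO :=
  ⟨S.φ '' E.1, by
    obtain ⟨e, he⟩ := E.2.1
    exact ⟨_, image_subset_iff.2 fun x hx => S.isMap_φ.mem_globalStable (he hx)⟩,
    E.compOpen.image_φ⟩

/-- The action of `φ⁻¹` on `CO^s`. -/
def CO.φ_symm (E : S.CO) : S.CO :=
  ⟨S.φ.symm '' E.1, by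
    obtain ⟨e, he⟩ := E.2.1
    exact ⟨_, image_subset_iff.2 fun x hx => S.isMap_φ_symm.mem_globalStable (he hx)⟩,
    E.compOpen.image_φ_symm⟩

/-- If `f` is injective on stable sets, then points of a stable set are close as soon as the forward
orbits of their images are close, uniformly. -/
theorem IsMap.exists_dist_iterate_lt (hf : S.IsMap T f) (hi : ∀ x, InjOn f (S.globalStable x))
    {c : ℝ} (hc : 0 < c) : ∃ η > 0, ∀ y y', y' ∈ S.globalStable y →
      (∀ n : ℕ, dist (T.φ^[n] (f y)) (T.φ^[n] (f y')) ≤ η) →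
        ∀ n : ℕ, dist (S.φ^[n] y) (S.φ^[n] y') < c ∧ S.LocS (S.φ^[n] y) (S.φ^[n] y') := by
  obtain ⟨δ, hδ, hδε, hs⟩ := S.exists_shadow
  obtain ⟨c₂, hc₂, hφ⟩ := exists_dist_lt_of_continuous S.φ.symm.continuous hδ
  -- `c` is the target bound, `c₂` keeps points within `δ` after one step back in time, and `δ` is
  -- the shadowing constant.
  obtain ⟨c₁, hc₁, h1c, h1c₂, h1δ⟩ : ∃ c₁ > 0, c₁ ≤ c ∧ c₁ ≤ c₂ ∧ c₁ ≤ δ :=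
    ⟨min c (min c₂ δ), lt_min hc (lt_min hc₂ hδ), min_le_left _ _,
      (min_le_right _ _).trans (min_le_left _ _), (min_le_right _ _).trans (min_le_right _ _)⟩
  -- `f` separates every pair in this compact set, so the distance of the images is bounded below on
  -- it. Pairs with closer images therefore cannot lie in `K`.
  let K : Set (A × A) := {p | dist p.1 p.2 ≤ S.ε} ∩ {p | S.bracket p.1 p.2 = p.2} ∩
    {p | c₁ ≤ dist p.1 p.2}
  have hcl : IsClosed {p : A × A | dist p.1 p.2 ≤ S.ε} := isClosed_le (by fun_prop) (by fun_prop)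
  have hK : IsCompact K := by
    refine IsClosed.isCompact (IsClosed.inter ?_ (isClosed_le (by fun_prop) (by fun_prop)))
    exact (S.continuousOn_bracket.prodMk continuousOn_snd).preimage_isClosed_of_isClosed hcl
      (t := {q : A × A | q.1 = q.2}) isClosed_diagonal
  have hf1 := hf.1
  obtain ⟨η, hη, hηK⟩ := hK.exists_forall_le' (f := fun p => dist (f p.1) (f p.2)) (a := 0)
    (by fun_prop) (by
      rintro ⟨a, b⟩ ⟨⟨h1, h2⟩, h3⟩
      refine dist_pos.2 fun h => ?_
      have := hi a (mem_globalStable_self a) (LocS.mem_globalStable ⟨h1, h2⟩) h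
      simp only [mem_ofPred_eq, this, dist_self] at h3
      linarith)
  refine ⟨η / 2, half_pos hη, fun y y' hy hd => ?_⟩
  obtain ⟨N, hN⟩ := Metric.tendsto_atTop.1 hy c₁ hc₁
  simp only [Real.dist_0_eq_abs, abs_of_nonneg dist_nonneg] at hN
  have hloc : ∀ n, (∀ m ≥ n, dist (S.φ^[m] y) (S.φ^[m] y') ≤ δ) →
      S.LocS (S.φ^[n] y) (S.φ^[n] y') := fun n hn =>
    ⟨(hn n le_rfl).trans hδε, hs _ _ fun k => by
      rw [← Function.iterate_add_apply, ← Function.iterate_add_apply]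
      exact hn _ (by omega)⟩
  -- The orbits are asymptotic, so the bound holds from some time `N` on; it is propagated back to
  -- time `0` by downward induction.
  have key : ∀ n ≤ N, ∀ m ≥ n, dist (S.φ^[m] y) (S.φ^[m] y') < c₁ := by
    intro n hn
    induction hn using Nat.decreasingInduction with
    | self => exact hN
    | of_succ n _ ih =>
      intro m hm
      rcases Nat.eq_or_lt_of_le hm with rfl | hm
      swap
      · exact ih m hm
      by_contra hcon
      -- One step back the points are still `δ`-close, hence in one local stable set. A distance of
      -- at least `c₁` would put the pair in `K`, against the bound on the images.
      have h1 := hφ _ _ ((ih (n + 1) le_rfl).trans_le h1c₂)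
      simp only [Function.iterate_succ_apply', S.φ.symm_apply_apply] at h1
      have h2 : S.LocS (S.φ^[n] y) (S.φ^[n] y') := by
        refine hloc n fun m hm => ?_
        rcases Nat.eq_or_lt_of_le hm with rfl | hm
        · exact h1.le
        · exact (ih m hm).le.trans h1δ
      have h3 := hηK (S.φ^[n] y, S.φ^[n] y') ⟨h2, not_lt.1 hcon⟩
      have h4 := hd n
      rw [← hf.iterate, ← hf.iterate] at h4
      simp only at h3
      linarith
  exact fun n => ⟨(key 0 (Nat.zero_le _) n (Nat.zero_le _)).trans_le h1c,
    hloc n fun m _ => (key 0 (Nat.zero_le _) m (Nat.zero_le _)).le.trans h1δ⟩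

/-- A point stably close to `f x` lifts to the stable set of `x` by surjectivity, and the lift is
close to `x` by `IsMap.exists_dist_iterate_lt`. -/
theorem SBijective.isOpen_image (hb : S.SBijective T f) (hf : S.IsMap T f) {V : Set A}
    (hV : IsOpen[S.stableTopology] V) : IsOpen[T.stableTopology] (f '' V) := by
  rw [isOpen_stable_iff] at hV ⊢
  rintro _ ⟨x, hx, rfl⟩
  obtain ⟨c, hc, hc', h⟩ := hV x hx
  obtain ⟨η, hη, hl⟩ := hf.exists_dist_iterate_lt (fun x => (hb x).injOn) hc
  refine ⟨min η T.ε, lt_min hη T.ε_pos, min_le_right _ _, fun y' hy' => ?_⟩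
  rw [mem_localStable (min_le_right _ _)] at hy'
  obtain ⟨x', hx', rfl⟩ := (hb x).surjOn hy'.2.mem_globalStable
  refine ⟨x', h ((mem_localStable hc').2 ?_), rfl⟩
  exact hl x x' hx' (fun n => (T.stable_iterate_le hy'.2.1 hy'.2.2 n).trans
    (hy'.1.le.trans (min_le_left _ _))) 0

/-- The image of a member of `CO^s` under an `s`-bijective map. -/
def CO.image (E : S.CO) (f : A → B) (hf : S.IsMap T f) (hb : S.SBijective T f) : T.CO :=
  ⟨f '' E.1, by
    obtain ⟨e, he⟩ := E.2.1
    exact ⟨_, image_subset_iff.2 fun x hx => (hb e).mapsTo (he hx)⟩,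
    hf.isCompact_image E.2.2.1, hb.isOpen_image hf E.2.2.2⟩

theorem IsMap.image_φ_image (hf : S.IsMap T f) (E : Set A) : f '' (S.φ '' E) = T.φ '' (f '' E) := by
  rw [image_image, image_image]
  exact image_congr fun x _ => hf.2 x

/-- Preservation of holonomy is assumed because `Holonomic` refers to the fixed scale `ε`, whereas
`exists_bracket_map` gives compatibility with brackets only at some smaller scale. -/
theorem exists_isPush (hf : S.IsMap T f) (hb : S.SBijective T f)
    (hol : ∀ E F, S.Holonomic E F → T.Holonomic (f '' E) (f '' F)) : ∃ g, S.IsPush T f g := by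
  suffices h : ∃ g : S.Ds →+ T.Ds, ∀ E, g (S.cls E) = T.cls (E.image f hf hb) by
    obtain ⟨g, hg⟩ := h
    exact ⟨g, fun E => ⟨_, rfl, hg E⟩⟩
  refine exists_Ds_hom _ ?_ ?_
  · intro E F h
    refine cls_eq_of_rel ?_
    induction h with
    | holonomic E F h => exact Rel.holonomic _ _ (hol _ _ h)
    | shift E F E' F' hE hF _ ih =>
      refine Rel.shift _ _ _ _ ?_ ?_ ih
      · exact (congrArg (f '' ·) hE).trans (hf.image_φ_image _)
      · exact (congrArg (f '' ·) hF).trans (hf.image_φ_image _)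
    | unshift E F E' F' hE hF _ ih =>
      refine Rel.unshift _ _ _ _ ?_ ?_ ih
      · exact (congrArg (f '' ·) hE).trans (hf.image_φ_image _)
      · exact (congrArg (f '' ·) hF).trans (hf.image_φ_image _)
    | refl E => exact Rel.refl _
    | symm E F _ ih => exact Rel.symm _ _ ih
    | trans E F G _ _ ih ih' => exact Rel.trans _ _ _ ih ih'
  · intro E F H hd hH
    -- `E` and `F` lie in one stable set, that of `H`; injectivity there keeps their images
    -- disjoint.
    obtain ⟨e, he⟩ := H.2.1
    refine cls_union ?_ ?_
    · rw [Set.disjoint_left]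
      rintro _ ⟨x, hx, rfl⟩ ⟨y, hy, hxy⟩
      have hy' := (hb e).injOn (he (hH ▸ Or.inr hy)) (he (hH ▸ Or.inl hx)) hxy
      exact Set.disjoint_left.1 hd hx (hy' ▸ hy)
    · exact (congrArg (f '' ·) hH).trans (image_union _ _ _)

theorem push_isPush (hf : S.IsMap T f) (hb : S.SBijective T f)
    (hol : ∀ E F, S.Holonomic E F → T.Holonomic (f '' E) (f '' F)) :
    S.IsPush T f (S.push T f) := by
  have h := exists_isPush hf hb hol
  rw [push, dif_pos h]
  exact h.choose_spec

theorem CO.ext {E F : S.CO} (h : E.1 = F.1) : E = F := Subtype.ext h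

/-- The automorphism of the dimension group induced by `φ` is injective. -/
theorem exists_shift_hom (S : SmaleSpace A) :
    ∃ g : S.Ds →+ S.Ds, Function.Injective g ∧ ∀ E : S.CO, g (S.cls E) = S.cls E.φ := by
  have hφ : ∀ E : S.CO, E.φ_symm.φ = E := fun E => CO.ext (by
    change S.φ '' (S.φ.symm '' E.1) = E.1
    simp [image_image])
  have hφ' : ∀ E : S.CO, E.φ.φ_symm = E := fun E => CO.ext (by
    change S.φ.symm '' (S.φ '' E.1) = E.1
    simp [image_image])
  obtain ⟨g, hg⟩ := exists_Ds_hom (S := S) (fun E => S.cls E.φ)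
    (fun E F h => cls_eq_of_rel (Rel.shift _ _ _ _ rfl rfl h))
    (fun E F H hd hH => cls_union (disjoint_image_of_injective S.φ.injective hd)
      ((congrArg (S.φ '' ·) hH).trans (image_union _ _ _)))
  -- The left inverse comes from `φ⁻¹`; `Rel.unshift` makes it well defined.
  obtain ⟨k, hk⟩ := exists_Ds_hom (S := S) (fun E => S.cls E.φ_symm)
    (fun E F h => cls_eq_of_rel (Rel.unshift _ _ E F (congrArg Subtype.val (hφ E).symm)
      (congrArg Subtype.val (hφ F).symm) h))
    (fun E F H hd hH => cls_union (disjoint_image_of_injective S.φ.symm.injective hd)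
      ((congrArg (S.φ.symm '' ·) hH).trans (image_union _ _ _)))
  have hkg : k.comp g = AddMonoidHom.id _ := Ds_hom_ext fun E => by
    simp [hg, hk, hφ']
  exact ⟨g, Function.LeftInverse.injective (g := k) fun x => DFunLike.congr_fun hkg x, hg⟩

end MapLemmas

end SmaleSpace

namespace SmaleSpace

/-! ### Preimages, unstable correspondences, and the contravariant homomorphism -/

section Correspondences

open Set Topology

variable {A B : Type*} [MetricSpace A] [CompactSpace A] [MetricSpace B] [CompactSpace B]
  {S : SmaleSpace A} {T : SmaleSpace B} {f : A → B}

theorem LocS.eq {x y : A} (h : S.LocS x y) (h' : S.inv.LocS x y) : x = y :=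
  h'.symm.2.symm.trans h.2

/-- The image of a partition under `φ`. -/
theorem IsPartition.image_φ {ι : Type*} {W : Set A} {P : ι → S.CO} (h : S.IsPartition W P) :
    S.IsPartition (S.φ '' W) fun i => (P i).φ := by
  refine ⟨fun i j hij => disjoint_image_of_injective S.φ.injective (h.1 i j hij), ?_⟩
  rw [← h.2, image_iUnion]
  rfl

theorem IsMap.preimage_image_φ (hf : S.IsMap T f) (E : Set B) :
    f ⁻¹' (T.φ '' E) = S.φ '' (f ⁻¹' E) := by
  rw [T.φ.image_eq_preimage_symm, S.φ.image_eq_preimage_symm]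
  ext x
  exact iff_of_eq (congrArg (· ∈ E) (hf.inv.2 x).symm)

/-- For close `a`, `a'` over `E`, flatness gives `f [a, a'] = [f a, f a'] = f a'`. Since `[a, a']`
is in the unstable set of `a'`, injectivity there gives `[a, a'] = a'`. -/
theorem IsMap.preimage_flat (hf : S.IsMap T f) (hi : ∀ x, InjOn f (S.globalUnstable x)) {E : Set B}
    (hE : T.Flat E) : S.Flat (f ⁻¹' E) := by
  obtain ⟨δ, hδ, hfl⟩ := hE
  obtain ⟨δ₁, hδ₁, hδ₁ε, hb⟩ := S.exists_bracket_map T hf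
  obtain ⟨δ₂, hδ₂, hδ₂ε, hn⟩ := S.bracket_near S.ε_pos
  obtain ⟨δ₃, hδ₃, hc⟩ := exists_dist_lt_of_continuous hf.1 hδ
  refine ⟨min δ₁ (min δ₂ (δ₃ / 2)), lt_min hδ₁ (lt_min hδ₂ (half_pos hδ₃)), ?_⟩
  intro a ha a' ha' hd
  have h1 := hd.trans (min_le_left _ _)
  have h2 := hd.trans ((min_le_right _ _).trans (min_le_left _ _))
  have h3 := hd.trans ((min_le_right _ _).trans (min_le_right _ _))
  obtain ⟨hw1, hw2⟩ := hn a a' h2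
  have l1 : S.LocS a (S.bracket a a') :=
    LocS.of_bracket (h1.trans hδ₁ε) (by rw [dist_comm]; exact hw1.le)
  have l2 : S.inv.LocS a' (S.bracket a a') :=
    LocS.of_bracket (S := S.inv) (by rw [dist_comm]; exact h1.trans hδ₁ε)
      (by rw [dist_comm]; exact hw2.le)
  have e : f (S.bracket a a') = f a' := by
    rw [hb a a' h1]
    exact (hfl _ ha _ ha' (hc _ _ (by linarith)).le).2
  have := hi a' l2.mem_globalStable (mem_globalStable_self (S := S.inv) a') e
  rwa [this] at l1

theorem CompOpen.preimage {E : Set B} (hE : T.CompOpen E) (hf : S.IsMap T f)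
    (hi : ∀ x, InjOn f (S.globalUnstable x)) : S.CompOpen (f ⁻¹' E) := by
  obtain ⟨h1, h2⟩ := isCompact_stable_iff.1 hE.1
  exact ⟨isCompact_stable_iff.2 ⟨(h1.isClosed.preimage hf.1).isCompact, hf.preimage_flat hi h2⟩,
    hf.isOpen_preimage hE.2⟩

variable (S) in
/-- `R` is the graph of a homeomorphism between `E` and `F` that moves points by at most `η` along
local unstable sets. -/
structure IsUnstableCorr (η : ℝ) (E F : Set A) (R : Set (A × A)) : Prop where
  isCompact : IsCompact R
  bijOn_fst : BijOn Prod.fst R E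
  bijOn_snd : BijOn Prod.snd R F
  dist_le : ∀ p ∈ R, dist p.1 p.2 ≤ η
  locS : ∀ p ∈ R, S.inv.LocS p.1 p.2

theorem isClosed_locS (S : SmaleSpace A) : IsClosed {p : A × A | S.LocS p.1 p.2} :=
  (S.continuousOn_bracket.prodMk continuousOn_snd).preimage_isClosed_of_isClosed
    (isClosed_le (by fun_prop) (by fun_prop)) (t := {q : A × A | q.1 = q.2}) isClosed_diagonal

theorem Holonomic.symm {E F : Set A} (h : S.Holonomic E F) : S.Holonomic F E :=
  ⟨h.2.1, h.1, fun e he f hf => by rw [dist_comm]; exact h.2.2.1 f hf e he, h.2.2.2.2, h.2.2.2.1⟩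

/-- The partner of `e` is `[y, e]` for any `y ∈ F`. It is unique because two partners share both a
local stable and a local unstable set. -/
theorem Holonomic.bijOn_fst {E F : Set A} (h : S.Holonomic E F) :
    BijOn Prod.fst {p : A × A | p.1 ∈ E ∧ p.2 ∈ F ∧ S.inv.LocS p.1 p.2} E := by
  obtain ⟨-, ⟨x, hx⟩, hd, hE, hF⟩ := h
  refine ⟨fun p hp => hp.1, ?_, ?_⟩
  · rintro ⟨e, e₁⟩ ⟨-, h1, h2⟩ ⟨e', e₂⟩ ⟨-, h3, h4⟩ (rfl : e = e')
    have hε := S.ε_pos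
    have m1 := (mem_localStable (by linarith)).1 (hx h1)
    have m2 := (mem_localStable (by linarith)).1 (hx h3)
    have hd : dist e₁ e₂ ≤ S.ε := by
      have := dist_triangle e₁ x e₂
      rw [dist_comm e₁ x] at this
      linarith
    exact congrArg (Prod.mk e) (LocS.eq (m1.2.symm.trans m2.2 hd) (h2.symm.trans h4 hd))
  · intro e he
    -- `F` is nonempty, since `e ∈ E = [E, F]`.
    obtain ⟨-, -, y, hy, -⟩ := hE.symm.subset he
    have hF' : S.bracket y e ∈ F := hF ▸ mem_image2_of_mem hy he
    refine ⟨(e, S.bracket y e), ⟨he, hF', hd _ he _ hF', ?_⟩, rfl⟩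
    have h1 := hd e he y hy
    have h2 := hd e he _ hF'
    rw [dist_comm] at h1 h2
    exact S.B3 _ _ _ h1 h2 h1

theorem Holonomic.exists_corr {E F : Set A} (h : S.Holonomic E F) (hE : IsCompact E)
    (hF : IsCompact F) : ∃ R, S.IsUnstableCorr S.ε E F R := by
  refine ⟨{p : A × A | p.1 ∈ E ∧ p.2 ∈ F ∧ S.inv.LocS p.1 p.2}, ?_, h.bijOn_fst, ?_,
    fun p hp => h.2.2.1 _ hp.1 _ hp.2.1, fun p hp => hp.2.2⟩
  · exact ((hE.isClosed.preimage continuous_fst).inter ((hF.isClosed.preimage continuous_snd).inter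
      S.inv.isClosed_locS)).isCompact
  · have hs := h.symm.bijOn_fst
    refine ⟨fun p hp => hp.2.1, ?_, ?_⟩
    · intro p hp q hq hpq
      have := hs.injOn (x₁ := p.swap) (x₂ := q.swap) ⟨hp.2.1, hp.1, hp.2.2.symm⟩
        ⟨hq.2.1, hq.1, hq.2.2.symm⟩ hpq
      exact Prod.swap_injective this
    · intro x hx
      obtain ⟨p, hp, rfl⟩ := hs.surjOn hx
      exact ⟨p.swap, ⟨hp.2.1, hp.1, hp.2.2.symm⟩, rfl⟩

/-- `φ⁻¹` contracts local unstable sets; iterating it makes the displacement small enough to lift.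
-/
theorem IsUnstableCorr.image_φ_symm {η : ℝ} {E F : Set A} {R : Set (A × A)}
    (h : S.IsUnstableCorr η E F R) :
    S.IsUnstableCorr (S.lam * η) (S.φ.symm '' E) (S.φ.symm '' F)
      (Prod.map S.φ.symm S.φ.symm '' R) where
  isCompact := h.isCompact.image (S.φ.symm.continuous.prodMap S.φ.symm.continuous)
  bijOn_fst := by
    rw [← h.bijOn_fst.image_eq, image_image]
    refine ⟨?_, ?_, ?_⟩
    · rintro _ ⟨p, hp, rfl⟩
      exact ⟨p, hp, rfl⟩
    · rintro _ ⟨p, hp, rfl⟩ _ ⟨q, hq, rfl⟩ hpq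
      rw [h.bijOn_fst.injOn hp hq (S.φ.symm.injective hpq)]
    · rintro _ ⟨p, hp, rfl⟩
      exact ⟨_, ⟨p, hp, rfl⟩, rfl⟩
  bijOn_snd := by
    rw [← h.bijOn_snd.image_eq, image_image]
    refine ⟨?_, ?_, ?_⟩
    · rintro _ ⟨p, hp, rfl⟩
      exact ⟨p, hp, rfl⟩
    · rintro _ ⟨p, hp, rfl⟩ _ ⟨q, hq, rfl⟩ hpq
      rw [h.bijOn_snd.injOn hp hq (S.φ.symm.injective hpq)]
    · rintro _ ⟨p, hp, rfl⟩
      exact ⟨_, ⟨p, hp, rfl⟩, rfl⟩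
  dist_le := by
    rintro _ ⟨p, hp, rfl⟩
    have hl := h.locS p hp
    exact (S.inv.C1 _ _ hl.1 hl.2).trans
      (mul_le_mul_of_nonneg_left (h.dist_le p hp) S.lam_pos.le)
  locS := by
    rintro _ ⟨p, hp, rfl⟩
    exact (h.locS p hp).φ

/-- A `u`-bijective map lifts unstable correspondences that move points very little. -/
theorem UBijective.exists_lift_corr (hu : S.UBijective T f) (hf : S.IsMap T f) {c : ℝ}
    (hc : 0 < c) : ∃ η > 0, ∀ E F R, T.IsUnstableCorr η E F R →
      ∃ R', S.IsUnstableCorr c (f ⁻¹' E) (f ⁻¹' F) R' := by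
  obtain ⟨η, hη, hl⟩ := hf.inv.exists_dist_iterate_lt (fun x => (hu x).injOn) hc
  -- `b` has a preimage `a'` in the unstable set of `a`. The backward orbits of `f a` and `b` stay
  -- `η`-close, so the estimate for the inverse systems bounds the distance from `a` to `a'`.
  have lift : ∀ a b, dist (f a) b ≤ η → T.inv.LocS (f a) b →
      ∃ a', f a' = b ∧ dist a a' ≤ c ∧ S.inv.LocS a a' := by
    intro a b hd hb
    obtain ⟨a', ha', rfl⟩ := (hu a).surjOn hb.mem_globalStable
    have := hl a a' ha' (fun n => (T.inv.stable_iterate_le hb.1 hb.2 n).trans hd) 0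
    exact ⟨a', rfl, this.1.le, this.2⟩
  have uniq : ∀ a a₁ a₂, S.inv.LocS a a₁ → S.inv.LocS a a₂ → f a₁ = f a₂ → a₁ = a₂ :=
    fun a a₁ a₂ h1 h2 h => (hu a).injOn h1.mem_globalStable h2.mem_globalStable h
  -- A point of `R` may have many pairs above it; the local unstable condition selects one partner
  -- for each point.
  refine ⟨η, hη, fun E F R hR => ⟨{p | (f p.1, f p.2) ∈ R} ∩ {p | dist p.1 p.2 ≤ c} ∩
    {p | S.inv.LocS p.1 p.2}, ?_, ?_, ?_, fun p hp => hp.1.2, fun p hp => hp.2⟩⟩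
  · refine (IsClosed.inter (IsClosed.inter ?_ (isClosed_le (by fun_prop) (by fun_prop)))
      S.inv.isClosed_locS).isCompact
    exact hR.isCompact.isClosed.preimage (hf.1.prodMap hf.1)
  · refine ⟨fun p hp => hR.bijOn_fst.mapsTo hp.1.1, ?_, ?_⟩
    · rintro ⟨a, a₁⟩ ⟨⟨h1, -⟩, h2⟩ ⟨a', a₂⟩ ⟨⟨h3, -⟩, h4⟩ (rfl : a = a')
      rw [uniq a a₁ a₂ h2 h4 (congrArg Prod.snd (hR.bijOn_fst.injOn h1 h3 rfl))]
    · intro a ha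
      obtain ⟨⟨x, b⟩, hp, rfl⟩ := hR.bijOn_fst.surjOn ha
      obtain ⟨a', rfl, h1, h2⟩ := lift a b (hR.dist_le _ hp) (hR.locS _ hp)
      exact ⟨(a, a'), ⟨⟨hp, h1⟩, h2⟩, rfl⟩
  · refine ⟨fun p hp => hR.bijOn_snd.mapsTo hp.1.1, ?_, ?_⟩
    · rintro ⟨a₁, a⟩ ⟨⟨h1, -⟩, h2⟩ ⟨a₂, a'⟩ ⟨⟨h3, -⟩, h4⟩ (rfl : a = a')
      rw [uniq a a₁ a₂ h2.symm h4.symm (congrArg Prod.fst (hR.bijOn_snd.injOn h1 h3 rfl))]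
    · intro a ha
      obtain ⟨⟨b, x⟩, hp, hx⟩ := hR.bijOn_snd.surjOn ha
      obtain rfl : x = f a := hx
      obtain ⟨a', rfl, h1, h2⟩ := lift a b (by rw [dist_comm]; exact hR.dist_le _ hp)
        (hR.locS _ hp).symm
      exact ⟨(a', a), ⟨⟨hp, by rw [mem_ofPred_eq, dist_comm]; exact h1⟩, h2.symm⟩, rfl⟩

variable (S) in
/-- `W` and `W'` have partitions with equivalent members. -/
def Equidecomposable (W W' : Set A) : Prop :=
  ∃ (n : ℕ) (P P' : Fin n → S.CO), S.IsPartition W P ∧ S.IsPartition W' P' ∧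
    ∀ i, S.Rel (P i) (P' i)

theorem Equidecomposable.image_φ {W W' : Set A} (h : S.Equidecomposable W W') :
    S.Equidecomposable (S.φ '' W) (S.φ '' W') := by
  obtain ⟨n, P, P', hP, hP', hr⟩ := h
  exact ⟨n, _, _, hP.image_φ, hP'.image_φ, fun i => Rel.shift _ _ _ _ rfl rfl (hr i)⟩

/-- A connected subset of `R` projects to a connected subset of the flat set `W`. That projection is
also connected in the stable topology, so it lies in one stable set and is at most a point; the
projection is injective on `R`. -/
theorem IsUnstableCorr.isTotallyDisconnected {η : ℝ} {W W' : Set A} {R : Set (A × A)}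
    (h : S.IsUnstableCorr η W W' R) (hW : S.CompOpen W)
    (htd : ∀ x, @IsTotallyDisconnected A S.stableTopology (S.globalStable x)) :
    IsTotallyDisconnected R := by
  intro t ht hpre
  have h1 : IsPreconnected (Prod.fst '' t) := hpre.image _ continuousOn_fst
  have hsub : Prod.fst '' t ⊆ W := (image_mono ht).trans h.bijOn_fst.image_eq.subset
  have h2 := @IsPreconnected.image A A _ S.stableTopology _ h1 id
    ((isCompact_stable_iff.1 hW.1).2.mono hsub).continuousOn
  rw [image_id] at h2
  intro p hp q hq
  have h3 : Prod.fst '' t ⊆ S.globalStable p.1 :=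
    @IsPreconnected.subset_isClopen A S.stableTopology _ _ h2
      ⟨isClosed_globalStable _, isOpen_globalStable _⟩
      ⟨p.1, mem_image_of_mem _ hp, mem_globalStable_self _⟩
  exact h.bijOn_fst.injOn (ht hp) (ht hq)
    (htd p.1 _ h3 h2 (mem_image_of_mem _ hp) (mem_image_of_mem _ hq))

/-- For `p`, `q` in a small piece, `p.1` may be replaced by `q.1` in the first slot of a bracket, so
`[p.1, q.2] = [q.1, q.2] = q.1`; symmetrically `[p.2, q.1] = q.2`. -/
theorem IsUnstableCorr.holonomic {η : ℝ} {W W' : Set A} {R C : Set (A × A)}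
    (h : S.IsUnstableCorr η W W' R) (hη : η ≤ S.ε / 4) (hC : C ⊆ R) {p₀ : A × A} (hp₀ : p₀ ∈ C)
    (h1 : ∀ p ∈ C, ∀ q ∈ C, dist p.1 q.1 < S.ε / 2 ∧ S.LocS p.1 q.1)
    (h2 : ∀ p ∈ C, ∀ q ∈ C, dist p.2 q.2 < S.ε / 2 ∧ S.LocS p.2 q.2) :
    S.Holonomic (Prod.fst '' C) (Prod.snd '' C) := by
  have hε := S.ε_pos
  -- At most `ε / 2` inside the piece plus a displacement of `ε / 4`.
  have hd : ∀ p ∈ C, ∀ q ∈ C, dist p.1 q.2 ≤ S.ε := fun p hp q hq => by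
    linarith [dist_triangle p.1 q.1 q.2, h.dist_le q (hC hq), (h1 p hp q hq).1]
  have e1 : ∀ p ∈ C, ∀ q ∈ C, S.bracket p.1 q.2 = q.1 := fun p hp q hq => by
    have l1 := (h1 p hp q hq).2
    have l2 := (h.locS q (hC hq)).symm
    have := S.B3 p.1 q.1 q.2 l1.1 (by rw [l1.2, dist_comm]; exact l2.1) (hd p hp q hq)
    rw [← this, l1.2]
    exact l2.2
  have e2 : ∀ p ∈ C, ∀ q ∈ C, S.bracket p.2 q.1 = q.2 := fun p hp q hq => by
    have l1 := (h2 p hp q hq).2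
    have l2 := h.locS q (hC hq)
    have := S.B3 p.2 q.2 q.1 l1.1 (by rw [l1.2, dist_comm]; exact l2.1)
      (by rw [dist_comm]; exact hd q hq p hp)
    rw [← this, l1.2]
    exact l2.2
  refine ⟨⟨p₀.1, ?_⟩, ⟨p₀.2, ?_⟩, ?_, ?_, ?_⟩
  · rintro _ ⟨p, hp, rfl⟩
    exact (mem_localStable (by linarith)).2 (h1 _ hp₀ _ hp)
  · rintro _ ⟨p, hp, rfl⟩
    exact (mem_localStable (by linarith)).2 (h2 _ hp₀ _ hp)
  · rintro _ ⟨p, hp, rfl⟩ _ ⟨q, hq, rfl⟩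
    exact hd p hp q hq
  · ext x
    constructor
    · rintro ⟨_, ⟨p, hp, rfl⟩, _, ⟨q, hq, rfl⟩, rfl⟩
      exact ⟨q, hq, (e1 p hp q hq).symm⟩
    · rintro ⟨q, hq, rfl⟩
      exact ⟨_, ⟨q, hq, rfl⟩, _, ⟨q, hq, rfl⟩, e1 q hq q hq⟩
  · ext x
    constructor
    · rintro ⟨_, ⟨p, hp, rfl⟩, _, ⟨q, hq, rfl⟩, rfl⟩
      exact ⟨q, hq, (e2 p hp q hq).symm⟩
    · rintro ⟨q, hq, rfl⟩
      exact ⟨_, ⟨q, hq, rfl⟩, _, ⟨q, hq, rfl⟩, e2 q hq q hq⟩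

/-- The projections of a relatively clopen subset of a correspondence are compact open. -/
theorem CompOpen.image_of_bijOn {W : Set A} {R C : Set (A × A)} {g : A × A → A}
    (hW : S.CompOpen W) (hg : BijOn g R W) (hgc : Continuous g) (hC : IsCompact C) (hCR : C ⊆ R)
    (hRC : IsCompact (R \ C)) : S.CompOpen (g '' C) := by
  have h1 : g '' C ⊆ W := (image_mono hCR).trans hg.image_eq.subset
  refine hW.of_clopen (hC.image hgc).isClosed (hRC.image hgc).isClosed
    (inter_eq_self_of_subset_right h1).symm ?_
  have h2 : W \ g '' C = g '' (R \ C) := by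
    rw [hg.injOn.image_sdiff_subset hCR, hg.image_eq]
  rw [h2, inter_eq_self_of_subset_right]
  exact (image_mono sdiff_subset).trans hg.image_eq.subset

theorem IsUnstableCorr.equidecomposable {η : ℝ} {W W' : Set A} {R : Set (A × A)}
    (h : S.IsUnstableCorr η W W' R) (hη : η ≤ S.ε / 4) (hW : S.CompOpen W) (hW' : S.CompOpen W')
    (htd : ∀ x, @IsTotallyDisconnected A S.stableTopology (S.globalStable x)) :
    S.Equidecomposable W W' := by
  have hε := S.ε_pos
  obtain ⟨δ, hδ, hfl⟩ := (isCompact_stable_iff.1 hW.1).2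
  obtain ⟨δ', hδ', hfl'⟩ := (isCompact_stable_iff.1 hW'.1).2
  -- Points of a piece inside an `r`-ball are less than `2 * r` apart. The bounds by `δ` and `δ'`
  -- make flatness of `W` and `W'` apply; the bound `ε / 2` is the size required by `Holonomic`.
  obtain ⟨r, hr, hr1, hr2, hr3⟩ : ∃ r > 0, 2 * r ≤ δ ∧ 2 * r ≤ δ' ∧ 2 * r ≤ S.ε / 2 :=
    ⟨min (δ / 2) (min (δ' / 2) (S.ε / 4)),
      lt_min (by linarith) (lt_min (by linarith) (by linarith)),
      by linarith [min_le_left (δ / 2) (min (δ' / 2) (S.ε / 4))],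
      by linarith [(min_le_right (δ / 2) (min (δ' / 2) (S.ε / 4))).trans (min_le_left _ _)],
      by linarith [(min_le_right (δ / 2) (min (δ' / 2) (S.ε / 4))).trans (min_le_right _ _)]⟩
  have : CompactSpace R := isCompact_iff_compactSpace.1 h.isCompact
  have : TotallyDisconnectedSpace R :=
    totallyDisconnectedSpace_subtype_iff.2 (h.isTotallyDisconnected hW htd)
  let U : R → TopologicalSpace.Opens R := fun p => ⟨Metric.ball p r, Metric.isOpen_ball⟩
  have hU : TopologicalSpace.IsOpenCover U := by
    exact TopologicalSpace.IsOpenCover.of_sets (fun _ => Metric.isOpen_ball)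
      (eq_univ_of_forall fun p => mem_iUnion.2 ⟨p, Metric.mem_ball_self hr⟩)
  -- Total disconnectedness enters here: `R` is a finite disjoint union of clopen sets, each inside
  -- one of the balls.
  obtain ⟨n, D, hD, hcov, hdisj⟩ := hU.exists_finite_nonempty_disjoint_clopen_cover
  let C : Fin n → Set (A × A) := fun i => Subtype.val '' (D i : Set R)
  have hCR : ∀ i, C i ⊆ R := fun i => by
    rintro _ ⟨p, -, rfl⟩
    exact p.2
  have hCd : ∀ i j, i ≠ j → Disjoint (C i) (C j) := fun i j hij =>
    disjoint_image_of_injective Subtype.val_injective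
      (TopologicalSpace.Clopens.coe_disjoint.2 (hdisj hij))
  have hCu : ⋃ i, C i = R := by
    rw [← image_iUnion, univ_subset_iff.1 hcov, image_univ, Subtype.range_coe]
  have hCc : ∀ i, IsCompact (C i) := fun i =>
    (D i).isClopen.isClosed.isCompact.image continuous_subtype_val
  have hCc' : ∀ i, IsCompact (R \ C i) := fun i => by
    have : R \ C i = Subtype.val '' (D i : Set R)ᶜ := by
      rw [image_compl_eq_range_sdiff_image Subtype.val_injective, Subtype.range_coe]
    rw [this]
    exact (D i).isClopen.compl.isClosed.isCompact.image continuous_subtype_val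
  have hdist : ∀ i, ∀ p ∈ C i, ∀ q ∈ C i, dist p q < 2 * r := by
    rintro i _ ⟨p, hp, rfl⟩ _ ⟨q, hq, rfl⟩
    obtain ⟨x, hx⟩ := (hD i).2
    have h1 : dist p x < r := hx hp
    have h2 : dist q x < r := hx hq
    change dist p q < _
    rw [dist_comm] at h2
    linarith [dist_triangle p x q]
  have hne : ∀ i, (C i).Nonempty := fun i => by
    refine Nonempty.image _ (nonempty_iff_ne_empty.2 fun h0 => (hD i).1 ?_)
    exact TopologicalSpace.Clopens.ext h0
  have h1 : ∀ i, ∀ p ∈ C i, ∀ q ∈ C i, dist p.1 q.1 < S.ε / 2 ∧ S.LocS p.1 q.1 := by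
    intro i p hp q hq
    have hd := (le_max_left _ _ : dist p.1 q.1 ≤ dist p q).trans_lt (hdist i p hp q hq)
    exact ⟨hd.trans_le hr3, hfl _ (h.bijOn_fst.mapsTo (hCR i hp)) _
      (h.bijOn_fst.mapsTo (hCR i hq)) (hd.le.trans hr1)⟩
  have h2 : ∀ i, ∀ p ∈ C i, ∀ q ∈ C i, dist p.2 q.2 < S.ε / 2 ∧ S.LocS p.2 q.2 := by
    intro i p hp q hq
    have hd := (le_max_right _ _ : dist p.2 q.2 ≤ dist p q).trans_lt (hdist i p hp q hq)
    exact ⟨hd.trans_le hr3, hfl' _ (h.bijOn_snd.mapsTo (hCR i hp)) _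
      (h.bijOn_snd.mapsTo (hCR i hq)) (hd.le.trans hr2)⟩
  choose p₀ hp₀ using hne
  let P : Fin n → S.CO := fun i => ⟨Prod.fst '' C i, ⟨(p₀ i).1, by
      rintro _ ⟨q, hq, rfl⟩
      exact (h1 i _ (hp₀ i) q hq).2.mem_globalStable⟩,
    hW.image_of_bijOn h.bijOn_fst continuous_fst (hCc i) (hCR i) (hCc' i)⟩
  let P' : Fin n → S.CO := fun i => ⟨Prod.snd '' C i, ⟨(p₀ i).2, by
      rintro _ ⟨q, hq, rfl⟩
      exact (h2 i _ (hp₀ i) q hq).2.mem_globalStable⟩,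
    hW'.image_of_bijOn h.bijOn_snd continuous_snd (hCc i) (hCR i) (hCc' i)⟩
  have hpart : ∀ (g : A × A → A) (V : Set A), BijOn g R V →
      (∀ i j, i ≠ j → Disjoint (g '' C i) (g '' C j)) ∧ ⋃ i, g '' C i = V := by
    intro g V hg
    refine ⟨fun i j hij => ?_, by rw [← image_iUnion, hCu, hg.image_eq]⟩
    rw [Set.disjoint_left]
    rintro _ ⟨p, hp, rfl⟩ ⟨q, hq, hpq⟩
    have := hg.injOn (hCR j hq) (hCR i hp) hpq
    exact Set.disjoint_left.1 (hCd i j hij) hp (this ▸ hq)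
  exact ⟨n, P, P', hpart _ _ h.bijOn_fst, hpart _ _ h.bijOn_snd, fun i =>
    Rel.holonomic _ _ (h.holonomic hη (hCR i) (hp₀ i) (h1 i) (h2 i))⟩

theorem Holonomic.equidecomposable_preimage {E F : Set B} (h : T.Holonomic E F)
    (hE : T.CompOpen E) (hF : T.CompOpen F) (hf : S.IsMap T f) (hu : S.UBijective T f)
    (htd : ∀ x, @IsTotallyDisconnected A S.stableTopology (S.globalStable x)) :
    S.Equidecomposable (f ⁻¹' E) (f ⁻¹' F) := by
  have hε := S.ε_pos
  obtain ⟨η₀, hη₀, hl⟩ := hu.exists_lift_corr hf (c := S.ε / 4) (by linarith)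
  have hi : ∀ x, InjOn f (S.globalUnstable x) := fun x => (hu x).injOn
  -- Here `n` counts the applications of `φ⁻¹` before the correspondence can be lifted; each is
  -- undone afterwards, as `f⁻¹` commutes with `φ` and equidecomposability is `φ`-invariant.
  have key : ∀ (n : ℕ) (E F : Set B) (R : Set (B × B)) (η : ℝ), T.CompOpen E → T.CompOpen F →
      T.IsUnstableCorr η E F R → T.lam ^ n * η ≤ η₀ → S.Equidecomposable (f ⁻¹' E) (f ⁻¹' F) := by
    intro n
    induction n with
    | zero =>
      intro E F R η hE hF hR hη
      rw [pow_zero, one_mul] at hη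
      obtain ⟨R', hR'⟩ := hl E F R ⟨hR.1, hR.2, hR.3, fun p hp => (hR.4 p hp).trans hη, hR.5⟩
      exact hR'.equidecomposable le_rfl (hE.preimage hf hi) (hF.preimage hf hi) htd
    | succ n ih =>
      intro E F R η hE hF hR hη
      have := (ih _ _ _ _ hE.image_φ_symm hF.image_φ_symm hR.image_φ_symm
        (by rw [← mul_assoc, ← pow_succ]; exact hη)).image_φ
      rw [← hf.preimage_image_φ, ← hf.preimage_image_φ] at this
      simpa [image_image] using this
  obtain ⟨R, hR⟩ := h.exists_corr (isCompact_of_stable hE.1) (isCompact_of_stable hF.1)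
  have hlim : Filter.Tendsto (fun n : ℕ => T.lam ^ n * T.ε) Filter.atTop (𝓝 (0 * T.ε)) :=
    (tendsto_pow_atTop_nhds_zero_of_lt_one T.lam_pos.le T.lam_lt_one).mul_const _
  rw [zero_mul] at hlim
  obtain ⟨n, hn⟩ := (hlim.eventually (gt_mem_nhds hη₀)).exists
  exact key n E F R T.ε hE hF hR hn.le

theorem exists_isPull (hf : S.IsMap T f) (hu : S.UBijective T f)
    (htd : ∀ x, @IsTotallyDisconnected A S.stableTopology (S.globalStable x)) :
    ∃ g, S.IsPull T f g := by
  have hi : ∀ x, InjOn f (S.globalUnstable x) := fun x => (hu x).injOn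
  have hex : ∀ E : T.CO, ∃ (n : ℕ) (P : Fin n → S.CO), S.IsPartition (f ⁻¹' E.1) P :=
    fun E => (E.compOpen.preimage hf hi).exists_isPartition
  choose n P hP using hex
  suffices h : ∃ g : T.Ds →+ S.Ds, ∀ E, g (T.cls E) = ∑ i, S.cls (P E i) by
    obtain ⟨g, hg⟩ := h
    exact ⟨g, fun E => ⟨⟨n E, P E, hP E⟩, fun m Q hQ => (hg E).trans ((hP E).sum_eq hQ)⟩⟩
  -- The shift is cancelled in the `unshift` case of the induction, which needs its injectivity.
  obtain ⟨s, hs, hsφ⟩ := S.exists_shift_hom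
  have hshift : ∀ E E' : T.CO, E'.1 = T.φ '' E.1 →
      ∑ i, S.cls (P E' i) = s (∑ i, S.cls (P E i)) := by
    intro E E' h
    have h1 := (hP E).image_φ
    rw [← hf.preimage_image_φ, ← h] at h1
    rw [(hP E').sum_eq h1, map_sum]
    exact Finset.sum_congr rfl fun i _ => (hsφ _).symm
  refine exists_Ds_hom _ ?_ ?_
  · intro E F h
    induction h with
    | holonomic E F h =>
      obtain ⟨m, Q, Q', hQ, hQ', hr⟩ :=
        h.equidecomposable_preimage E.compOpen F.compOpen hf hu htd
      rw [(hP E).sum_eq hQ, (hP F).sum_eq hQ']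
      exact Finset.sum_congr rfl fun i _ => cls_eq_of_rel (hr i)
    | shift E F E' F' hE hF _ ih => rw [hshift E E' hE, hshift F F' hF, ih]
    | unshift E F E' F' hE hF _ ih =>
      rw [hshift E E' hE, hshift F F' hF] at ih
      exact hs ih
    | refl E => rfl
    | symm E F _ ih => exact ih.symm
    | trans E F G _ _ ih ih' => exact ih.trans ih'
  · intro E F H hd hH
    have h1 : S.IsPartition (f ⁻¹' H.1) (Sum.elim (P E) (P F)) := by
      have hsE : ∀ i, (P E i).1 ⊆ f ⁻¹' E.1 := fun i => by
        rw [← (hP E).2]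
        exact subset_iUnion (fun i => (P E i).1) i
      have hsF : ∀ i, (P F i).1 ⊆ f ⁻¹' F.1 := fun i => by
        rw [← (hP F).2]
        exact subset_iUnion (fun i => (P F i).1) i
      have hd' := hd.preimage f
      refine ⟨?_, ?_⟩
      · rintro (i | i) (j | j) hij
        · exact (hP E).1 i j fun h => hij (h ▸ rfl)
        · exact hd'.mono (hsE i) (hsF j)
        · exact hd'.symm.mono (hsF i) (hsE j)
        · exact (hP F).1 i j fun h => hij (h ▸ rfl)
      · rw [iUnion_sum, hH, preimage_union, ← (hP E).2, ← (hP F).2]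
        rfl
    rw [(hP H).sum_eq h1, Fintype.sum_sum_type]
    rfl

theorem pull_isPull (hf : S.IsMap T f) (hu : S.UBijective T f)
    (htd : ∀ x, @IsTotallyDisconnected A S.stableTopology (S.globalStable x)) :
    S.IsPull T f (S.pull T f) := by
  have h := exists_isPull hf hu htd
  rw [pull, dif_pos h]
  exact h.choose_spec

end Correspondences

/-! ### Uniqueness and composition of the induced homomorphisms -/

section Functoriality

open Set

variable {A B C : Type*} [MetricSpace A] [CompactSpace A] [MetricSpace B] [CompactSpace B]
  [MetricSpace C] [CompactSpace C] {S : SmaleSpace A} {T : SmaleSpace B} {U : SmaleSpace C}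

theorem IsPush.unique {f : A → B} {g h : S.Ds →+ T.Ds} (hg : S.IsPush T f g)
    (hh : S.IsPush T f h) : g = h := by
  refine Ds_hom_ext fun E => ?_
  obtain ⟨E₁, h1, h1'⟩ := hg E
  obtain ⟨E₂, h2, h2'⟩ := hh E
  rw [h1', h2', CO.ext (h1.trans h2.symm)]

theorem IsPush.id : S.IsPush S id (AddMonoidHom.id _) := fun E => ⟨E, by simp, rfl⟩

theorem IsPush.comp {f : A → B} {f' : B → C} {g : S.Ds →+ T.Ds} {g' : T.Ds →+ U.Ds}
    (hg : S.IsPush T f g) (hg' : T.IsPush U f' g') : S.IsPush U (f' ∘ f) (g'.comp g) := by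
  intro E
  obtain ⟨E₁, h1, h1'⟩ := hg E
  obtain ⟨E₂, h2, h2'⟩ := hg' E₁
  exact ⟨E₂, by rw [h2, h1, image_image]; rfl, by rw [AddMonoidHom.comp_apply, h1', h2']⟩

/-- `IsPull` with partitions indexed by arbitrary finite types. -/
theorem IsPull.apply {f : A → B} {g : T.Ds →+ S.Ds} (hg : S.IsPull T f g) {E : T.CO}
    {ι : Type*} [Fintype ι] {P : ι → S.CO} (hP : S.IsPartition (f ⁻¹' E.1) P) :
    g (T.cls E) = ∑ i, S.cls (P i) := by
  obtain ⟨⟨n, Q, hQ⟩, h⟩ := hg E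
  exact (h n Q hQ).trans (IsPartition.sum_eq hQ hP)

theorem IsPartition.single (E : S.CO) : S.IsPartition E.1 fun _ : Unit => E :=
  ⟨fun _ _ h => (h rfl).elim, iUnion_const _⟩

theorem IsPull.id_unique {g : S.Ds →+ S.Ds} (hg : S.IsPull S id g) : g = AddMonoidHom.id _ := by
  refine Ds_hom_ext fun E => ?_
  rw [hg.apply (P := fun _ : Unit => E) (IsPartition.single E)]
  simp

/-- Partitioning `f'⁻¹(E)` and then the preimage of each piece gives one partition of the preimage
under the composite, and `h` may be evaluated on it. -/
theorem IsPull.comp_unique {f : A → B} {f' : B → C} {g : T.Ds →+ S.Ds} {g' : U.Ds →+ T.Ds}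
    {h : U.Ds →+ S.Ds} (hg : S.IsPull T f g) (hg' : T.IsPull U f' g')
    (hh : S.IsPull U (f' ∘ f) h) : h = g.comp g' := by
  refine Ds_hom_ext fun E => ?_
  obtain ⟨⟨n, P, hP⟩, h1⟩ := hg' E
  choose m Q hQ using fun i => (hg (P i)).1
  have hQ' : S.IsPartition (f' ∘ f ⁻¹' E.1) (fun x : Σ i, Fin (m i) => Q x.1 x.2) := by
    refine IsPartition.sigma (V := fun i => f ⁻¹' (P i).1)
      (fun i j hij => (hP.1 i j hij).preimage f) ?_ hQ
    rw [← preimage_iUnion, hP.2]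
    rfl
  rw [hh.apply hQ', AddMonoidHom.comp_apply, h1 n P hP, map_sum, Fintype.sum_sigma]
  exact Finset.sum_congr rfl fun i _ => ((hg (P i)).2 _ _ (hQ i)).symm

end Functoriality

end SmaleSpace

/-! ### Holonomy under bracket-preserving contractions -/

namespace SmaleSpace

/-- Contractions that preserve brackets preserve holonomic pairs. -/
theorem Holonomic.image {A B : Type*} [MetricSpace A] [CompactSpace A] [MetricSpace B]
    [CompactSpace B] {S : SmaleSpace A} {T : SmaleSpace B} {f : A → B} {E F : Set A}
    (h : S.Holonomic E F) (hd : ∀ x y, dist (f x) (f y) ≤ dist x y) (hε : T.ε = S.ε)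
    (hb : ∀ x y, dist x y ≤ S.ε → f (S.bracket x y) = T.bracket (f x) (f y)) :
    T.Holonomic (f '' E) (f '' F) := by
  have hloc : ∀ e, f '' S.localStable e (S.ε / 2) ⊆ T.localStable (f e) (T.ε / 2) := by
    rintro e _ ⟨x, hx, rfl⟩
    refine ⟨(hd _ _).trans_lt (hε ▸ hx.1), ?_⟩
    rw [← hb, hx.2]
    have := S.ε_pos
    rw [dist_comm]
    linarith [hx.1]
  have him : ∀ U V : Set A, (∀ u ∈ U, ∀ v ∈ V, dist u v ≤ S.ε) →
      Set.image2 T.bracket (f '' U) (f '' V) = f '' Set.image2 S.bracket U V := by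
    intro U V hUV
    rw [Set.image2_image_left, Set.image2_image_right, Set.image_image2]
    exact Set.image2_congr fun u hu v hv => (hb u v (hUV u hu v hv)).symm
  obtain ⟨⟨e, he⟩, ⟨x, hx⟩, hEF, h1, h2⟩ := h
  refine ⟨⟨f e, (Set.image_mono he).trans (hloc e)⟩, ⟨f x, (Set.image_mono hx).trans (hloc x)⟩,
    ?_, ?_, ?_⟩
  · rintro _ ⟨u, hu, rfl⟩ _ ⟨v, hv, rfl⟩
    exact (hd u v).trans (hε ▸ hEF u hu v hv)
  · rw [him E F hEF, h1]
  · rw [him F E fun u hu v hv => by rw [dist_comm]; exact hEF v hv u hu, h2]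

end SmaleSpace

namespace SUBijectivePair

open Set Topology SmaleSpace

/-! ### The structure maps of `Σ_{L,M}` and base change -/

section FibreProducts

variable {X Y Z : Type*} [MetricSpace X] [CompactSpace X] [MetricSpace Y] [CompactSpace Y]
  [MetricSpace Z] [CompactSpace Z] {S : SmaleSpace X} (π : SUBijectivePair S Y Z)

theorem isMap_fst {L M : ℕ} (l : Fin (L + 1)) : (π.sig L M).IsMap π.SY fun p => p.1.1 l :=
  ⟨by fun_prop, fun _ => rfl⟩

theorem isMap_snd {L M : ℕ} (m : Fin (M + 1)) : (π.sig L M).IsMap π.SZ fun p => p.1.2 m :=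
  ⟨by fun_prop, fun _ => rfl⟩

theorem tendsto_dist {L M : ℕ} {u v : ℕ → π.Sig L M}
    (h1 : ∀ l, Filter.Tendsto (fun n => dist ((u n).1.1 l) ((v n).1.1 l)) Filter.atTop (𝓝 0))
    (h2 : ∀ m, Filter.Tendsto (fun n => dist ((u n).1.2 m) ((v n).1.2 m)) Filter.atTop (𝓝 0)) :
    Filter.Tendsto (fun n => dist (u n) (v n)) Filter.atTop (𝓝 0) := by
  -- The maximum metric is bounded by the sum of the coordinate distances.
  have h3 := (tendsto_finsetSum Finset.univ fun l _ => h1 l).add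
    (tendsto_finsetSum Finset.univ fun m _ => h2 m)
  simp only [Finset.sum_const_zero, add_zero] at h3
  refine squeeze_zero (fun _ => dist_nonneg) (fun n => ?_) h3
  have p1 : ∀ l, dist ((u n).1.1 l) ((v n).1.1 l) ≤ ∑ l, dist ((u n).1.1 l) ((v n).1.1 l) :=
    fun l => Finset.single_le_sum (f := fun l => dist ((u n).1.1 l) ((v n).1.1 l))
      (fun _ _ => dist_nonneg) (Finset.mem_univ l)
  have p2 : ∀ m, dist ((u n).1.2 m) ((v n).1.2 m) ≤ ∑ m, dist ((u n).1.2 m) ((v n).1.2 m) :=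
    fun m => Finset.single_le_sum (f := fun m => dist ((u n).1.2 m) ((v n).1.2 m))
      (fun _ _ => dist_nonneg) (Finset.mem_univ m)
  have q1 : 0 ≤ ∑ l, dist ((u n).1.1 l) ((v n).1.1 l) := Finset.sum_nonneg fun _ _ => dist_nonneg
  have q2 : 0 ≤ ∑ m, dist ((u n).1.2 m) ((v n).1.2 m) := Finset.sum_nonneg fun _ _ => dist_nonneg
  exact π.dist_le_of _ _ (add_nonneg q1 q2) (fun l => (p1 l).trans (le_add_of_nonneg_right q2))
    fun m => (p2 m).trans (le_add_of_nonneg_left q1)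

theorem mem_globalStable_iff {L M : ℕ} {p q : π.Sig L M} :
    q ∈ (π.sig L M).globalStable p ↔ (∀ l, q.1.1 l ∈ π.SY.globalStable (p.1.1 l)) ∧
      ∀ m, q.1.2 m ∈ π.SZ.globalStable (p.1.2 m) := by
  refine ⟨fun h => ⟨fun l => (π.isMap_fst l).mem_globalStable h,
    fun m => (π.isMap_snd m).mem_globalStable h⟩, fun h => π.tendsto_dist (fun l => ?_) fun m => ?_⟩
  · simp only [(π.isMap_fst l).iterate]
    exact h.1 l
  · simp only [(π.isMap_snd m).iterate]
    exact h.2 m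

theorem mem_globalUnstable_iff {L M : ℕ} {p q : π.Sig L M} :
    q ∈ (π.sig L M).globalUnstable p ↔ (∀ l, q.1.1 l ∈ π.SY.globalUnstable (p.1.1 l)) ∧
      ∀ m, q.1.2 m ∈ π.SZ.globalUnstable (p.1.2 m) := by
  have e1 : ∀ (l : Fin (L + 1)) (n : ℕ) (x : π.Sig L M),
      ((π.sig L M).φ.symm^[n] x).1.1 l = π.SY.φ.symm^[n] (x.1.1 l) :=
    fun l => (π.isMap_fst l).inv.iterate
  have e2 : ∀ (m : Fin (M + 1)) (n : ℕ) (x : π.Sig L M),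
      ((π.sig L M).φ.symm^[n] x).1.2 m = π.SZ.φ.symm^[n] (x.1.2 m) :=
    fun m => (π.isMap_snd m).inv.iterate
  refine ⟨fun h => ⟨fun l => (π.isMap_fst l).inv.mem_globalStable h,
    fun m => (π.isMap_snd m).inv.mem_globalStable h⟩,
    fun h => π.tendsto_dist (fun l => ?_) fun m => ?_⟩
  · simp only [e1]
    exact h.1 l
  · simp only [e2]
    exact h.2 m

/-- The `z`-coordinates of a connected subset are constant because the stable sets of `Z` are
totally disconnected. They fix the base point, which determines the `y`-coordinates by injectivity
of `π_s` on stable sets. -/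
theorem isTotallyDisconnected_globalStable (L M : ℕ) (p : π.Sig L M) :
    @IsTotallyDisconnected _ (π.sig L M).stableTopology ((π.sig L M).globalStable p) := by
  intro t ht hpre a ha b hb
  have hz : ∀ m, a.1.2 m = b.1.2 m := by
    intro m
    have h1 := @IsPreconnected.image _ _ (π.sig L M).stableTopology π.SZ.stableTopology t hpre
      (fun p => p.1.2 m) (@Continuous.continuousOn _ _ (π.sig L M).stableTopology
        π.SZ.stableTopology _ t (π.isMap_snd m).continuous_stable)
    refine π.totallyDisconnected_stable (p.1.2 m) _ ?_ h1 (mem_image_of_mem _ ha)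
      (mem_image_of_mem _ hb)
    rintro _ ⟨q, hq, rfl⟩
    exact (π.mem_globalStable_iff.1 (ht hq)).2 m
  refine Subtype.ext (Prod.ext (funext fun l => ?_) (funext hz))
  refine (π.sBijective_πs (p.1.1 l)).injOn ((π.mem_globalStable_iff.1 (ht ha)).1 l)
    ((π.mem_globalStable_iff.1 (ht hb)).1 l) ?_
  rw [a.2 l 0, b.2 l 0, hz]

variable {L L' M M' : ℕ} (α : Fin (L' + 1) → Fin (L + 1)) (β : Fin (M' + 1) → Fin (M + 1))

theorem isMap_reindexY : (π.sig L M).IsMap (π.sig L' M) (π.reindexY M α) :=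
  ⟨by unfold reindexY; fun_prop, fun _ => rfl⟩

theorem isMap_reindexZ : (π.sig L M).IsMap (π.sig L M') (π.reindexZ L β) :=
  ⟨by unfold reindexZ; fun_prop, fun _ => rfl⟩

/-- Within a stable set, the `z`-coordinates determine the base point and hence every `y_l`, whether
or not `α` hits `l`. -/
theorem sBijective_reindexY : (π.sig L M).SBijective (π.sig L' M) (π.reindexY M α) := by
  intro p
  refine ⟨fun q hq => (π.isMap_reindexY α).mem_globalStable hq, ?_, ?_⟩
  · intro q hq r hr hqr
    have hz : q.1.2 = r.1.2 := congrArg (fun x => x.1.2) hqr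
    refine Subtype.ext (Prod.ext (funext fun l => ?_) hz)
    refine (π.sBijective_πs (p.1.1 l)).injOn ((π.mem_globalStable_iff.1 hq).1 l)
      ((π.mem_globalStable_iff.1 hr).1 l) ?_
    rw [q.2 l 0, r.2 l 0, hz]
  · intro q' hq'
    obtain ⟨h1, h2⟩ := π.mem_globalStable_iff.1 hq'
    have h3 : π.πu (q'.1.2 0) ∈ S.globalStable (π.πu (p.1.2 0)) :=
      π.isMap_πu.mem_globalStable (h2 0)
    -- Each `y_l` is the lift of the new base point to the stable set of the old `y_l`; at the
    -- indices `α l` uniqueness of the lift gives back the coordinates of `q'`.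
    have h4 : ∀ l, ∃ y ∈ π.SY.globalStable (p.1.1 l), π.πs y = π.πu (q'.1.2 0) := fun l => by
      rw [← p.2 l 0] at h3
      exact (π.sBijective_πs (p.1.1 l)).surjOn h3
    choose y hy hy' using h4
    have h5 : ∀ m, π.πu (q'.1.2 m) = π.πu (q'.1.2 0) := fun m => by rw [← q'.2 0 m, q'.2 0 0]
    refine ⟨⟨(y, q'.1.2), fun l m => (hy' l).trans (h5 m).symm⟩, π.mem_globalStable_iff.2 ⟨hy, h2⟩, ?_⟩
    refine Subtype.ext (Prod.ext (funext fun l => ?_) rfl)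
    refine (π.sBijective_πs (p.1.1 (α l))).injOn (hy (α l)) (h1 l) ?_
    exact (hy' _).trans (q'.2 l 0).symm

/-- The mirror image of `sBijective_reindexY`: within an unstable set the `y`-coordinates determine
the `z`-coordinates. -/
theorem uBijective_reindexZ : (π.sig L M).UBijective (π.sig L M') (π.reindexZ L β) := by
  intro p
  refine ⟨fun q hq => (π.isMap_reindexZ β).inv.mem_globalStable hq, ?_, ?_⟩
  · intro q hq r hr hqr
    have hy : q.1.1 = r.1.1 := congrArg (fun x => x.1.1) hqr
    refine Subtype.ext (Prod.ext hy (funext fun m => ?_))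
    refine (π.uBijective_πu (p.1.2 m)).injOn ((π.mem_globalUnstable_iff.1 hq).2 m)
      ((π.mem_globalUnstable_iff.1 hr).2 m) ?_
    rw [← q.2 0 m, ← r.2 0 m, hy]
  · intro q' hq'
    obtain ⟨h1, h2⟩ := π.mem_globalUnstable_iff.1 hq'
    have h3 : π.πs (q'.1.1 0) ∈ S.globalUnstable (π.πs (p.1.1 0)) :=
      π.isMap_πs.inv.mem_globalStable (h1 0)
    have h4 : ∀ m, ∃ z ∈ π.SZ.globalUnstable (p.1.2 m), π.πu z = π.πs (q'.1.1 0) := fun m => by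
      rw [p.2 0 m] at h3
      exact (π.uBijective_πu (p.1.2 m)).surjOn h3
    choose z hz hz' using h4
    have h5 : ∀ l, π.πs (q'.1.1 l) = π.πs (q'.1.1 0) := fun l => by rw [q'.2 l 0, q'.2 0 0]
    refine ⟨⟨(q'.1.1, z), fun l m => by rw [hz', h5]⟩, π.mem_globalUnstable_iff.2 ⟨h1, hz⟩, ?_⟩
    refine Subtype.ext (Prod.ext rfl (funext fun m => ?_))
    refine (π.uBijective_πu (p.1.2 (β m))).injOn (hz (β m)) (h2 m) ?_
    exact (hz' _).trans (q'.2 0 m)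

theorem dist_reindexY_le (p q : π.Sig L M) :
    dist (π.reindexY M α p) (π.reindexY M α q) ≤ dist p q :=
  π.dist_le_of _ _ dist_nonneg (fun l => π.dist_fst_le p q (α l)) (π.dist_snd_le p q)

theorem holonomic_reindexY {E F : Set (π.Sig L M)} (h : (π.sig L M).Holonomic E F) :
    (π.sig L' M).Holonomic (π.reindexY M α '' E) (π.reindexY M α '' F) := by
  refine h.image (π.dist_reindexY_le α) rfl fun p q hpq => Subtype.ext ?_
  have h1 := π.sigBracket_coe hpq
  have h2 := π.sigBracket_coe ((π.dist_reindexY_le α p q).trans hpq)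
  refine Eq.trans ?_ h2.symm
  exact congrArg (fun x : (Fin (L + 1) → Y) × (Fin (M + 1) → Z) => (x.1 ∘ α, x.2)) h1

theorem isPush_covY :
    (π.sig L M).IsPush (π.sig L' M) (π.reindexY M α) (π.covY M α) :=
  push_isPush (π.isMap_reindexY α) (π.sBijective_reindexY α) fun _ _ => π.holonomic_reindexY α

theorem isPull_conZ :
    (π.sig L M).IsPull (π.sig L M') (π.reindexZ L β) (π.conZ L β) :=
  pull_isPull (π.isMap_reindexZ β) (π.uBijective_reindexZ β)
    (π.isTotallyDisconnected_globalStable L M)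

/-- Base change: `α^*` maps `(β^*)⁻¹(E)` onto `(β^*)⁻¹(α^*(E))`. -/
theorem image_preimage_reindex (E : Set (π.Sig L M')) :
    π.reindexY M α '' (π.reindexZ L β ⁻¹' E) = π.reindexZ L' β ⁻¹' (π.reindexY M' α '' E) := by
  ext q
  constructor
  · rintro ⟨p, hp, rfl⟩
    exact ⟨_, hp, rfl⟩
  · rintro ⟨p, hp, hpq⟩
    have hy : (fun l => p.1.1 (α l)) = q.1.1 := congrArg (fun x => x.1.1) hpq
    have hz : p.1.2 = fun m => q.1.2 (β m) := congrArg (fun x => x.1.2) hpq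
    -- `p` and `q` lie over the same point of `X`, because they share the `y`-coordinate with index
    -- `α 0`.
    have h1 : ∀ l m, π.πs (p.1.1 l) = π.πu (q.1.2 m) := fun l m => by
      rw [← q.2 0 m, ← hy, p.2 l 0, ← p.2 (α 0) 0]
    refine ⟨⟨(p.1.1, q.1.2), h1⟩, ?_, Subtype.ext (Prod.ext hy rfl)⟩
    have h2 : π.reindexZ L β ⟨(p.1.1, q.1.2), h1⟩ = p := Subtype.ext (Prod.ext rfl hz.symm)
    rw [mem_preimage, h2]
    exact hp

/-- The preimage may meet several stable sets, so `s`-bijectivity does not apply to it directly. It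
applies to `β^* p` and `β^* q`, which lie in `E`, and gives equal `y`-coordinates; `α^*` already
preserves the `z`-coordinates. -/
theorem injOn_reindexY_preimage (E : (π.sig L M').CO) :
    InjOn (π.reindexY M α) (π.reindexZ L β ⁻¹' E.1) := by
  intro p hp q hq hpq
  obtain ⟨e, he⟩ := E.2.1
  have h1 : π.reindexZ L β p = π.reindexZ L β q :=
    (π.sBijective_reindexY α e).injOn (he hp) (he hq) (congrArg (π.reindexZ L' β) hpq)
  exact Subtype.ext (Prod.ext (congrArg (fun x => x.1.1) h1) (congrArg (fun x => x.1.2) hpq))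

/-- By base change and injectivity, `α^*` carries a partition of `(β^*)⁻¹(E)` to a partition of
`(β^*)⁻¹(α^*(E))`. -/
theorem covY_comp_conZ :
    (π.covY M α).comp (π.conZ L β) = (π.conZ L' β).comp (π.covY M' α) := by
  refine Ds_hom_ext fun E => ?_
  obtain ⟨⟨n, P, hP⟩, h⟩ := π.isPull_conZ (L := L) β E
  obtain ⟨E', hE', hE⟩ := π.isPush_covY α E
  choose P' hP' hPP' using fun i => π.isPush_covY α (P i)
  have hsub : ∀ i, (P i).1 ⊆ π.reindexZ L β ⁻¹' E.1 := fun i => by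
    rw [← hP.2]
    exact subset_iUnion (fun i => (P i).1) i
  have hpart : (π.sig L' M).IsPartition (π.reindexZ L' β ⁻¹' E'.1) P' := by
    constructor
    · intro i j hij
      rw [hP', hP', Set.disjoint_left]
      rintro _ ⟨p, hp, rfl⟩ ⟨q, hq, hpq⟩
      have := π.injOn_reindexY_preimage α β E (hsub j hq) (hsub i hp) hpq
      exact Set.disjoint_left.1 (hP.1 i j hij) hp (this ▸ hq)
    · rw [hE', ← π.image_preimage_reindex, ← hP.2, image_iUnion]
      exact iUnion_congr hP'
  rw [AddMonoidHom.comp_apply, AddMonoidHom.comp_apply, h n P hP, hE, map_sum,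
    (π.isPull_conZ β).apply hpart]
  exact Finset.sum_congr rfl fun i _ => hPP' i

theorem dsFunctorial : π.DsFunctorial where
  covY_id _ _ := (π.isPush_covY id).unique IsPush.id
  covY_comp _ α α' :=
    (π.isPush_covY (α ∘ α')).unique ((π.isPush_covY α).comp (π.isPush_covY α'))
  conZ_id _ _ := (π.isPull_conZ id).id_unique
  conZ_comp _ _ _ _ β β' := (π.isPull_conZ β).comp_unique (π.isPull_conZ β')
    (π.isPull_conZ (β ∘ β'))
  comm α β := π.covY_comp_conZ α β

end FibreProducts

end SUBijectivePair

namespace SUBijectivePair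

/-! ### Comparison with Putnam's double complex -/

section DoubleComplex

variable {X Y Z : Type*} [MetricSpace X] [CompactSpace X] [MetricSpace Y] [CompactSpace Y]
  [MetricSpace Z] [CompactSpace Z] {S : SmaleSpace X} (π : SUBijectivePair S Y Z)

theorem dsObject_dh (h : π.DsFunctorial) (L M : ℕ) :
    (unnormalizedDoubleComplex (π.dsObject h)).dh L M = AddCommGrpCat.ofHom (π.dS L M) := by
  have h1 : ((AlgebraicTopology.alternatingFaceMapComplex _).obj (π.dsObject h)).d (L + 1) L =
      AlgebraicTopology.AlternatingFaceMapComplex.objD (π.dsObject h) L :=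
    AlgebraicTopology.alternatingFaceMapComplex_obj_d _ _
  refine (congrArg (fun f => NatTrans.app f (SimplexCategory.mk M)) h1).trans ?_
  -- Evaluation at `[M]` as an additive map, so that it can be moved inside the alternating sum.
  let e : ((π.dsObject h).obj (op (SimplexCategory.mk (L + 1))) ⟶
      (π.dsObject h).obj (op (SimplexCategory.mk L))) →+
        ((π.sig (L + 1) M).Ds →+ (π.sig L M).Ds) :=
    { toFun f := (f.app (SimplexCategory.mk M)).hom
      map_zero' := rfl
      map_add' _ _ := rfl }
  apply AddCommGrpCat.hom_ext
  change e (∑ i : Fin (L + 2), (-1 : ℤ) ^ (i : ℕ) • (π.dsObject h).δ i) = π.dS L M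
  rw [map_sum, dS]
  refine Finset.sum_congr rfl fun i _ => ?_
  rw [map_zsmul]
  rfl

theorem dsObject_dv (h : π.DsFunctorial) (L M : ℕ) :
    (unnormalizedDoubleComplex (π.dsObject h)).dv L M = AddCommGrpCat.ofHom (π.dSStar L M) := by
  have h1 : ((AlgebraicTopology.alternatingCofaceMapComplex _).obj
      ((π.dsObject h).obj (op (SimplexCategory.mk L)))).d M (M + 1) =
      AlgebraicTopology.AlternatingCofaceMapComplex.objD
        ((π.dsObject h).obj (op (SimplexCategory.mk L))) M :=
    CochainComplex.of_d (fun n => Functor.obj ((π.dsObject h).obj (op (SimplexCategory.mk L)))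
      (SimplexCategory.mk n)) _ M
  refine (congrArg (fun f => (-1 : ℤ) ^ L • f) h1).trans ?_
  let K := (π.dsObject h).obj (op (SimplexCategory.mk L))
  let e : (Functor.obj K (SimplexCategory.mk M) ⟶
      Functor.obj K (SimplexCategory.mk (M + 1))) →+
        ((π.sig L M).Ds →+ (π.sig L (M + 1)).Ds) :=
    AddCommGrpCat.homAddEquiv.toAddMonoidHom
  apply AddCommGrpCat.hom_ext
  change e ((-1 : ℤ) ^ L • ∑ i : Fin (M + 2), (-1 : ℤ) ^ (i : ℕ) •
    CosimplicialObject.δ K i) = π.dSStar L M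
  rw [map_zsmul, map_sum, dSStar, Finset.smul_sum]
  refine Finset.sum_congr rfl fun i _ => ?_
  -- The column sign `(-1)^L` and the coface sign combine to `(-1)^(L+m)`.
  rw [map_zsmul, smul_smul, ← pow_add]
  rfl

/-- The relations are inherited from the unnormalized double complex, whose differentials have been
identified with `dS` and `dSStar`. -/
theorem isDoubleComplex (h : π.DsFunctorial) : π.IsDoubleComplex where
  dS_dS L M := by
    have := (unnormalizedDoubleComplex (π.dsObject h)).dh_dh L M
    rw [dsObject_dh, dsObject_dh] at this
    exact congrArg AddCommGrpCat.Hom.hom this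
  dSStar_dSStar L M := by
    have := (unnormalizedDoubleComplex (π.dsObject h)).dv_dv L M
    rw [dsObject_dv, dsObject_dv] at this
    exact congrArg AddCommGrpCat.Hom.hom this
  anticomm L M := by
    have := (unnormalizedDoubleComplex (π.dsObject h)).anticomm L M
    rw [dsObject_dv, dsObject_dv, dsObject_dh, dsObject_dh] at this
    exact congrArg AddCommGrpCat.Hom.hom this

theorem unnormalizedDoubleComplex_eq (h : π.DsFunctorial) :
    unnormalizedDoubleComplex (π.dsObject h) = π.putnamComplex (π.isDoubleComplex h) := by
  have hdh : (unnormalizedDoubleComplex (π.dsObject h)).dh =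
      (π.putnamComplex (π.isDoubleComplex h)).dh := funext₂ fun L M => π.dsObject_dh h L M
  have hdv : (unnormalizedDoubleComplex (π.dsObject h)).dv =
      (π.putnamComplex (π.isDoubleComplex h)).dv := funext₂ fun L M => π.dsObject_dv h L M
  -- The two families of objects agree by definition, so only the differentials have to be compared.
  have ext : ∀ (o : ℕ → ℕ → AddCommGrpCat) (a a' : ∀ L M, o (L + 1) M ⟶ o L M)
      (b b' : ∀ L M, o L M ⟶ o L (M + 1)) (h1 h2 h3 h1' h2' h3'), a = a' → b = b' →
      MixedDoubleComplex.mk o a b h1 h2 h3 = MixedDoubleComplex.mk o a' b' h1' h2' h3' := by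
    rintro o a _ b _ h1 h2 h3 h1' h2' h3' rfl rfl
    rfl
  exact ext _ _ _ _ _ _ _ _ _ _ _ hdh hdv

end DoubleComplex

end SUBijectivePair

theorem mainTheorem8 {X Y Z : Type*} [MetricSpace X] [CompactSpace X] [MetricSpace Y]
    [CompactSpace Y] [MetricSpace Z] [CompactSpace Z] (S : SmaleSpace X) (hS : S.NonWandering)
    (π : SUBijectivePair S Y Z) :
    -- the induced maps on dimension groups exist
    (∀ (L L' M : ℕ) (α : Fin (L' + 1) →o Fin (L + 1)),
      (π.sig L M).IsPush (π.sig L' M) (π.reindexY M α) (π.covY M α)) ∧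
    (∀ (L M M' : ℕ) (β : Fin (M' + 1) →o Fin (M + 1)),
      (π.sig L M).IsPull (π.sig L M') (π.reindexZ L β) (π.conZ L β)) ∧
    -- they form a simplicial cosimplicial abelian group
    ∃ h : π.DsFunctorial,
      -- with the stated faces, degeneracies, cofaces and codegeneracies
      (∀ (L M : ℕ) (l : Fin (L + 2)),
        ((π.dsObject h).δ l).app (SimplexCategory.mk M) =
          AddCommGrpCat.ofHom ((π.sig (L + 1) M).push (π.sig L M) (π.faceY L M l))) ∧
      (∀ (L M : ℕ) (l : Fin (L + 1)),
        ((π.dsObject h).σ l).app (SimplexCategory.mk M) =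
          AddCommGrpCat.ofHom ((π.sig L M).push (π.sig (L + 1) M) (π.degenY L M l))) ∧
      (∀ (L M : ℕ) (m : Fin (M + 2)),
        CosimplicialObject.δ ((π.dsObject h).obj (op (SimplexCategory.mk L))) m =
          AddCommGrpCat.ofHom ((π.sig L (M + 1)).pull (π.sig L M) (π.faceZ L M m))) ∧
      (∀ (L M : ℕ) (m : Fin (M + 1)),
        CosimplicialObject.σ ((π.dsObject h).obj (op (SimplexCategory.mk L))) m =
          AddCommGrpCat.ofHom ((π.sig L M).pull (π.sig L (M + 1)) (π.degenZ L M m))) ∧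
      -- whose unnormalized double complex is Putnam's double complex
      ∃ h' : π.IsDoubleComplex,
        unnormalizedDoubleComplex (π.dsObject h) = π.putnamComplex h' := by
  exact ⟨fun L L' M α => π.isPush_covY α, fun L M M' β => π.isPull_conZ β, π.dsFunctorial, fun _ _ _ => rfl,
    fun _ _ _ => rfl, fun _ _ _ => rfl, fun _ _ _ => rfl, π.isDoubleComplex π.dsFunctorial,
    π.unnormalizedDoubleComplex_eq π.dsFunctorial⟩
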